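/- For finite sets $A, B\subseteq\mathbb R$ write $AB=\{ab : a\in A,\ b\in B\}$ and $A+1=\{a+1 : a\in A\}$, so that $A(A+1)=\{a(b+1) : a,b\in A\}$. There are absolute constants $c>0$ and $k\in\mathbb N$ such that for every finite set $A\subseteq\mathbb R$ $$|A(A+1)| \;\ge\; c\,\frac{|A|^{49/38}}{(\log(|A|+2))^{k}} ,$$ and there are absolute constants $c>0$ and $k\in\mathbb N$ such that for all finite sets $A,B\subseteq\mathbb R$ $$|AB| + |(A+1)(B+1)| \;\ge\; c\,\frac{(|A||B|)^{49/76}}{(\log(|A||B|+2))^{k}} .$$ -/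

import Mathlib

open scoped Pointwise

/-! If `z x = a` and `w y = a + 1`, then the point `(z, w)` lies on the line `w y = z x + 1`.
Szemerédi–Trotter therefore prevents a set and its shift by 1 from both being multiplicatively
structured. Structure is measured by the decay constant in `IsRich`. Logarithms and constants are
dropped below.

Regularisation (`exists_subset_isRich_isRich`): a large subset `U` of `A` has decay constants for
`U` and `U + 1` with product about `|U|^3`. An extremal witness for the first constant yields many
elements with many representations `z x`, and the incidence bound then leaves few representations `w
y` of their shifts on average.

Group theory (`card_mul_card_pow_le`): decay constants `α`, `β` of `A`, `B` give `(|A||B|)^41 ≤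
|AB|^38 (αβ)^11`. Counting triples `(a₁, a₂, b)` with `a₁ / a₂` a frequent quotient and `a₁ b`, `a₂
b` popular products bounds the quotient energy of a large `A' ⊆ A`. The same holds for some `B' ⊆
B`, and Cauchy–Schwarz gives `(|A'||B'|)^4 ≤ |A'B'|^2 E(A') E(B')`.

Apply this to regularised subsets `U`, `V` of `A`, `B` and to their shifts, then multiply. The decay
constants contribute `(|U||V|)^33`, and `82 - 33 = 49` is the exponent against
`(|UV||(U+1)(V+1)|)^38`. The one-set bound is the case `B = -(A + 1)`. -/

open Finset

/-! ### Cauchy–Schwarz and collision counts -/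

section Collisions

variable {α β : Type*} [DecidableEq β]

/-- The ordered pairs of elements of `s` with the same image, counted by fibres. -/
theorem card_collisions (s : Finset α) (g : α → β) :
    #{p ∈ s ×ˢ s | g p.1 = g p.2} = ∑ b ∈ s.image g, #{x ∈ s | g x = b} ^ 2 := by
  have hmaps : ∀ p ∈ {p ∈ s ×ˢ s | g p.1 = g p.2}, g p.1 ∈ s.image g := by
    intro p hp
    simp only [mem_filter, mem_product] at hp
    exact mem_image_of_mem _ hp.1.1
  rw [card_eq_sum_card_fiberwise hmaps]
  refine sum_congr rfl fun b _ => ?_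
  rw [sq, ← card_product]
  congr 1
  ext p
  simp only [mem_filter, mem_product]
  constructor
  · rintro ⟨⟨⟨h1, h2⟩, h3⟩, h4⟩
    exact ⟨⟨h1, h4⟩, h2, h3 ▸ h4⟩
  · rintro ⟨⟨h1, h4⟩, h2, h3⟩
    exact ⟨⟨⟨h1, h2⟩, h4.trans h3.symm⟩, h4⟩

theorem card_sq_le_card_image_mul_collisions (s : Finset α) (g : α → β) :
    #s ^ 2 ≤ #(s.image g) * #{p ∈ s ×ˢ s | g p.1 = g p.2} := by
  rw [card_collisions, card_eq_sum_card_image g s]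
  exact sq_sum_le_card_mul_sum_sq

/-- Sum `2n ≤ 1 + n^2` over fibres. The factor 2 lets the diagonal collisions be cancelled later. -/
theorem two_mul_card_le_card_image_add_collisions (s : Finset α) (g : α → β) :
    2 * #s ≤ #(s.image g) + #{p ∈ s ×ˢ s | g p.1 = g p.2} := by
  rw [card_collisions, card_eq_sum_card_image g s, mul_sum, card_eq_sum_ones (s.image g),
    ← sum_add_distrib]
  refine sum_le_sum fun b _ => ?_
  nlinarith [sq_nonneg ((#{x ∈ s | g x = b} : ℤ) - 1)]

end Collisions

/-! ### A Szemerédi–Trotter bound for Cartesian products, by cells -/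

section Incidences

/-- The number of elements of `Z` below `z`, in blocks of length `q`. -/
noncomputable def block (Z : Finset ℝ) (q : ℕ) (z : ℝ) : ℕ := #{z' ∈ Z | z' < z} / q

theorem block_mono (Z : Finset ℝ) (q : ℕ) : Monotone (block Z q) := by
  intro z z' h
  refine Nat.div_le_div_right (card_le_card ?_)
  intro x hx
  simp only [mem_filter] at hx ⊢
  exact ⟨hx.1, hx.2.trans_le h⟩

theorem block_le (Z : Finset ℝ) (q : ℕ) (z : ℝ) : block Z q z ≤ #Z / q :=
  Nat.div_le_div_right (card_filter_le _ _)

theorem card_block_fiber_le (Z : Finset ℝ) {q : ℕ} (hq : 0 < q) (i : ℕ) :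
    #{z ∈ Z | block Z q z = i} ≤ q := by
  have : #{z ∈ Z | block Z q z = i} ≤ #(Finset.Ico (i * q) (i * q + q)) := by
    refine card_le_card_of_injOn (fun z => #{z' ∈ Z | z' < z}) ?_ ?_
    · intro z hz
      rw [mem_coe, mem_filter, block] at hz
      simp only [coe_Ico, Set.mem_Ico]
      have h1 := Nat.div_add_mod (#{z' ∈ Z | z' < z}) q
      have h2 := Nat.mod_lt (#{z' ∈ Z | z' < z}) hq
      rw [hz.2, mul_comm] at h1
      exact ⟨h1 ▸ Nat.le_add_right _ _, by omega⟩
    · have key : ∀ z ∈ Z, ∀ z', z < z' → #{x ∈ Z | x < z} < #{x ∈ Z | x < z'} := by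
        intro z hz z' h
        refine card_lt_card ?_
        rw [Finset.ssubset_iff_of_subset]
        · exact ⟨z, by simp [hz, h], by simp⟩
        · intro x hx
          simp only [mem_filter] at hx ⊢
          exact ⟨hx.1, hx.2.trans h⟩
      intro z hz z' hz' h
      rw [mem_coe, mem_filter] at hz hz'
      simp only at h
      by_contra hne
      rcases lt_or_gt_of_ne hne with h' | h'
      · exact absurd h (key z hz.1 z' h').ne
      · exact absurd h (key z' hz'.1 z h').ne'
  simpa using this

/-- The incidences `w * y = z * x + 1` between points `(z, w)` and lines `(x, y)`. -/
noncomputable def incidences (Z W X Y : Finset ℝ) : Finset ((ℝ × ℝ) × (ℝ × ℝ)) :=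
  {p ∈ (Z ×ˢ W) ×ˢ (X ×ˢ Y) | p.1.2 * p.2.2 = p.1.1 * p.2.1 + 1}

theorem card_incidences_eq_sum (Z W X Y : Finset ℝ) :
    #(incidences Z W X Y) =
      ∑ l ∈ X ×ˢ Y, #{p ∈ Z ×ˢ W | p.2 * l.2 = p.1 * l.1 + 1} := by
  rw [incidences, card_filter, sum_product_right]
  simp_rw [card_filter]

/-- Point–line duality, which allows the assumption that there are at least as many points as lines.
-/
theorem card_incidences_symm (Z W X Y : Finset ℝ) :
    #(incidences Z W X Y) = #(incidences X Y Z W) := by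
  refine card_bij' (fun p _ => (p.2, p.1)) (fun p _ => (p.2, p.1)) ?_ ?_ ?_ ?_ <;>
    simp +contextual [incidences, mul_comm]

/-- A line with nonzero coefficients meets few cells. -/
theorem card_cells_le (Z W : Finset ℝ) (q₁ q₂ : ℕ) {x y : ℝ} (hy : y ≠ 0) :
    #({p ∈ Z ×ˢ W | p.2 * y = p.1 * x + 1}.image fun p => (block Z q₁ p.1, block W q₂ p.2)) ≤
      #Z / q₁ + #W / q₂ + 1 := by
  set S := {p ∈ Z ×ˢ W | p.2 * y = p.1 * x + 1} with hS
  have hw : ∀ p ∈ S, p.2 = p.1 * (x / y) + 1 / y := by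
    intro p hp
    have := (mem_filter.1 hp).2
    field_simp
    linarith
  rw [← card_range (#Z / q₁ + #W / q₂ + 1)]
  -- For nonnegative slope both block indices increase along the line, so their sum determines the
  -- cell. For nonpositive slope the index in `W` is reversed.
  rcases le_total 0 (x / y) with h | h
  · refine card_le_card_of_injOn (fun c => c.1 + c.2) ?_ ?_
    · intro c hc
      simp only [coe_image, Set.mem_image, mem_coe] at hc
      obtain ⟨p, hp, rfl⟩ := hc
      have h1 := block_le Z q₁ p.1
      have h2 := block_le W q₂ p.2
      simp only [coe_range, Set.mem_Iio]
      omega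
    · intro c hc c' hc' hcc
      simp only [coe_image, Set.mem_image, mem_coe] at hc hc'
      obtain ⟨p, hp, rfl⟩ := hc
      obtain ⟨p', hp', rfl⟩ := hc'
      simp only [Prod.mk.injEq] at hcc ⊢
      rcases le_total p.1 p'.1 with hle | hle
      · have h1 := block_mono Z q₁ hle
        have h2 : block W q₂ p.2 ≤ block W q₂ p'.2 := by
          apply block_mono
          rw [hw p hp, hw p' hp']
          gcongr
        omega
      · have h1 := block_mono Z q₁ hle
        have h2 : block W q₂ p'.2 ≤ block W q₂ p.2 := by
          apply block_mono
          rw [hw p hp, hw p' hp']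
          gcongr
        omega
  · refine card_le_card_of_injOn (fun c => c.1 + (#W / q₂ - c.2)) ?_ ?_
    · intro c hc
      simp only [coe_image, Set.mem_image, mem_coe] at hc
      obtain ⟨p, hp, rfl⟩ := hc
      have h1 := block_le Z q₁ p.1
      have h2 := block_le W q₂ p.2
      simp only [coe_range, Set.mem_Iio]
      omega
    · intro c hc c' hc' hcc
      simp only [coe_image, Set.mem_image, mem_coe] at hc hc'
      obtain ⟨p, hp, rfl⟩ := hc
      obtain ⟨p', hp', rfl⟩ := hc'
      simp only [Prod.mk.injEq] at hcc ⊢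
      have h3 := block_le W q₂ p.2
      have h4 := block_le W q₂ p'.2
      rcases le_total p.1 p'.1 with hle | hle
      · have h1 := block_mono Z q₁ hle
        have h2 : block W q₂ p'.2 ≤ block W q₂ p.2 := by
          apply block_mono
          rw [hw p hp, hw p' hp']
          have := mul_le_mul_of_nonpos_right hle h
          linarith
        omega
      · have h1 := block_mono Z q₁ hle
        have h2 : block W q₂ p.2 ≤ block W q₂ p'.2 := by
          apply block_mono
          rw [hw p hp, hw p' hp']
          have := mul_le_mul_of_nonpos_right hle h
          linarith
        omega

/-- Two distinct points lie on at most one of the lines `w * y = z * x + 1`. -/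
theorem line_unique {z w z' w' x y x' y' : ℝ} (hne : (z, w) ≠ (z', w'))
    (h1 : w * y = z * x + 1) (h2 : w' * y = z' * x + 1)
    (h3 : w * y' = z * x' + 1) (h4 : w' * y' = z' * x' + 1) : (x, y) = (x', y') := by
  -- The line misses the origin, so proportional points on it coincide.
  have hdet : w * z' - w' * z ≠ 0 := by
    intro h0
    apply hne
    have e1 : z = z' := by linear_combination (z' * h1 - z * h2) - y * h0
    have e2 : w = w' := by linear_combination (w' * h1 - w * h2) - x * h0
    rw [e1, e2]
  have ex : (w * z' - w' * z) * (x - x') = 0 := by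
    linear_combination w' * h1 - w * h2 - w' * h3 + w * h4
  have ey : (w * z' - w' * z) * (y - y') = 0 := by
    linear_combination z' * h1 - z * h2 - z' * h3 + z * h4
  have := (mul_eq_zero.1 ex).resolve_left hdet
  have := (mul_eq_zero.1 ey).resolve_left hdet
  ext <;> simp only <;> linarith

/-- A line carries at most as many points as it meets cells, plus its ordered pairs of distinct
points sharing a cell. Such a pair determines the line, and each point has at most `q₁ * q₂`
partners. -/
theorem card_incidences_le_cells (Z W X Y : Finset ℝ) (hY : ∀ y ∈ Y, y ≠ 0) {q₁ q₂ : ℕ}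
    (hq₁ : 0 < q₁) (hq₂ : 0 < q₂) :
    #(incidences Z W X Y) ≤
      (#X * #Y) * (#Z / q₁ + #W / q₂ + 1) + (#Z * #W) * (q₁ * q₂) := by
  classical
  set c : ℝ × ℝ → ℕ × ℕ := fun p => (block Z q₁ p.1, block W q₂ p.2) with hc
  set S : ℝ × ℝ → Finset (ℝ × ℝ) := fun l => {p ∈ Z ×ˢ W | p.2 * l.2 = p.1 * l.1 + 1} with hS
  have hI : #(incidences Z W X Y) = ∑ l ∈ X ×ˢ Y, #(S l) := card_incidences_eq_sum Z W X Y
  have hoff : ∑ l ∈ X ×ˢ Y, #{p ∈ S l ×ˢ S l | p.1 ≠ p.2 ∧ c p.1 = c p.2} ≤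
      (#Z * #W) * (q₁ * q₂) := by
    have h1 : ∑ l ∈ X ×ˢ Y, #{p ∈ S l ×ˢ S l | p.1 ≠ p.2 ∧ c p.1 = c p.2} ≤
        #{p ∈ (Z ×ˢ W) ×ˢ (Z ×ˢ W) | c p.2 = c p.1} := by
      rw [← card_sigma]
      refine card_le_card_of_injOn (fun a => a.2) ?_ ?_
      · rintro ⟨l, p⟩ hp
        simp only [coe_sigma, Set.mem_sigma_iff, mem_coe, mem_filter, mem_product, hS] at hp ⊢
        exact ⟨⟨hp.2.1.1.1, hp.2.1.2.1⟩, hp.2.2.2.symm⟩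
      · rintro ⟨l, p⟩ hp ⟨l', p'⟩ hp' h
        simp only [coe_sigma, Set.mem_sigma_iff, mem_coe, mem_filter, hS] at hp hp'
        simp only at h
        subst h
        rw [mem_product (s := filter _ _), mem_filter, mem_filter] at hp hp'
        have := line_unique (z := p.1.1) (w := p.1.2) (z' := p.2.1) (w' := p.2.2) hp.2.2.1
          hp.2.1.1.2 hp.2.1.2.2 hp'.2.1.1.2 hp'.2.1.2.2
        have hl : l = l' := this
        subst hl
        rfl
    refine h1.trans ?_
    rw [card_filter, sum_product, ← card_product, ← smul_eq_mul]
    refine sum_le_card_nsmul _ _ _ fun p _ => ?_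
    rw [← card_filter]
    calc #{p' ∈ Z ×ˢ W | c p' = c p}
        ≤ #({z ∈ Z | block Z q₁ z = (c p).1} ×ˢ {w ∈ W | block W q₂ w = (c p).2}) := by
          refine card_le_card fun p' hp' => ?_
          simp only [mem_filter, mem_product] at hp' ⊢
          rw [← hp'.2]
          exact ⟨⟨hp'.1.1, rfl⟩, hp'.1.2, rfl⟩
      _ ≤ q₁ * q₂ := by
          rw [card_product]
          exact Nat.mul_le_mul (card_block_fiber_le Z hq₁ _) (card_block_fiber_le W hq₂ _)
  have hline : ∀ l ∈ X ×ˢ Y, #(S l) ≤ (#Z / q₁ + #W / q₂ + 1) +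
      #{p ∈ S l ×ˢ S l | p.1 ≠ p.2 ∧ c p.1 = c p.2} := by
    intro l hl
    have h1 := two_mul_card_le_card_image_add_collisions (S l) c
    have h2 : #((S l).image c) ≤ #Z / q₁ + #W / q₂ + 1 :=
      card_cells_le Z W q₁ q₂ (hY _ (mem_product.1 hl).2)
    have h3 : #{p ∈ S l ×ˢ S l | c p.1 = c p.2} ≤
        #(S l) + #{p ∈ S l ×ˢ S l | p.1 ≠ p.2 ∧ c p.1 = c p.2} := by
      rw [← Finset.diag_card (S l)]
      refine (card_le_card ?_).trans (card_union_le _ _)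
      intro p hp
      simp only [mem_filter, mem_product, mem_union, mem_diag] at hp ⊢
      by_cases h : p.1 = p.2
      · exact Or.inl ⟨hp.1.1, h⟩
      · exact Or.inr ⟨hp.1, h, hp.2⟩
    omega
  rw [hI]
  refine (sum_le_sum hline).trans ?_
  rw [sum_add_distrib, sum_const, smul_eq_mul, card_product]
  exact Nat.add_le_add_left hoff _

theorem card_incidences_le_left (Z W X Y : Finset ℝ) (hY : ∀ y ∈ Y, y ≠ 0) :
    #(incidences Z W X Y) ≤ (#X * #Y) * #Z := by
  rw [← card_product, ← card_product]
  refine card_le_card_of_injOn (fun p => (p.2, p.1.1)) ?_ ?_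
  · intro p hp
    simp only [incidences, mem_coe, mem_filter, mem_product] at hp
    simp only [coe_product, Set.mem_prod, mem_coe]
    exact ⟨hp.1.2, hp.1.1.1⟩
  · rintro ⟨⟨z, w⟩, x, y⟩ hp ⟨⟨z', w'⟩, x', y'⟩ hp' h
    simp only [incidences, mem_coe, mem_filter, mem_product] at hp hp'
    simp only [Prod.mk.injEq] at h ⊢
    obtain ⟨⟨rfl, rfl⟩, rfl⟩ := h
    exact ⟨⟨rfl, mul_right_cancel₀ (hY y hp.1.2.2) (hp.2.trans hp'.2.symm)⟩, rfl, rfl⟩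

theorem card_incidences_le_right (Z W X Y : Finset ℝ) (hX : ∀ x ∈ X, x ≠ 0) :
    #(incidences Z W X Y) ≤ (#X * #Y) * #W := by
  rw [← card_product, ← card_product]
  refine card_le_card_of_injOn (fun p => (p.2, p.1.2)) ?_ ?_
  · intro p hp
    simp only [incidences, mem_coe, mem_filter, mem_product] at hp
    simp only [coe_product, Set.mem_prod, mem_coe]
    exact ⟨hp.1.2, hp.1.1.2⟩
  · rintro ⟨⟨z, w⟩, x, y⟩ hp ⟨⟨z', w'⟩, x', y'⟩ hp' h
    simp only [incidences, mem_coe, mem_filter, mem_product] at hp hp'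
    simp only [Prod.mk.injEq] at h ⊢
    obtain ⟨⟨rfl, rfl⟩, rfl⟩ := h
    refine ⟨⟨mul_right_cancel₀ (hX x hp.1.2.1) ?_, rfl⟩, rfl, rfl⟩
    linarith [hp.2, hp'.2]

theorem card_incidences_cube_le_of_le (Z W X Y : Finset ℝ) (hX : ∀ x ∈ X, x ≠ 0)
    (hY : ∀ y ∈ Y, y ≠ 0) (hle : #X * #Y ≤ #Z * #W) :
    (#(incidences Z W X Y) : ℝ) ^ 3 ≤ 343 * ((#Z : ℝ) * #W * #X * #Y) ^ 2 := by
  rcases Nat.eq_zero_or_pos (#X * #Y) with h0 | hN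
  · have h := card_incidences_le_left Z W X Y hY
    rw [h0, zero_mul, Nat.le_zero] at h
    rw [h, Nat.cast_zero, zero_pow three_ne_zero]
    positivity
  set N : ℝ := (#X : ℝ) * #Y with hNdef
  set P : ℝ := (#Z : ℝ) * #W with hPdef
  have hN1 : 1 ≤ N := by rw [hNdef]; exact_mod_cast hN
  have hNP : N ≤ P := by rw [hNdef, hPdef]; exact_mod_cast hle
  have hP1 : 1 ≤ P := hN1.trans hNP
  -- Blocks of lengths about `#Z / r` and `#W / r` make the two terms of the cell bound about `r N`
  -- and `P^2 / r^2`; this `r` balances them. `N ≤ P` gives `r ≥ 1`, which absorbs the `+ 1`.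
  set r : ℝ := (P ^ 2 / N) ^ ((1 : ℝ) / 3) with hr
  have hq0 : 1 ≤ P ^ 2 / N := by
    rw [le_div_iff₀ (by linarith)]
    nlinarith
  have hr3 : r ^ 3 = P ^ 2 / N := by
    rw [hr, ← Real.rpow_natCast, ← Real.rpow_mul (by linarith)]
    norm_num
  have hr1 : 1 ≤ r := Real.one_le_rpow hq0 (by norm_num)
  have hr0 : 0 < r := by linarith
  have hrN : r ^ 3 * N = P ^ 2 := by rw [hr3]; field_simp
  suffices h : (#(incidences Z W X Y) : ℝ) ≤ 7 * (r * N) by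
    calc (#(incidences Z W X Y) : ℝ) ^ 3 ≤ (7 * (r * N)) ^ 3 := by gcongr
      _ = 343 * (r ^ 3 * N) * N ^ 2 := by ring
      _ = 343 * ((#Z : ℝ) * #W * #X * #Y) ^ 2 := by rw [hrN, hPdef, hNdef]; ring
  have hrN0 : 0 ≤ r * N := by positivity
  by_cases hZ : (#Z : ℝ) < r
  · have h : (#(incidences Z W X Y) : ℝ) ≤ N * #Z := by
      rw [hNdef]; exact_mod_cast card_incidences_le_left Z W X Y hY
    nlinarith
  by_cases hW : (#W : ℝ) < r
  · have h : (#(incidences Z W X Y) : ℝ) ≤ N * #W := by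
      rw [hNdef]; exact_mod_cast card_incidences_le_right Z W X Y hX
    nlinarith
  rw [not_lt] at hZ hW
  set q₁ := ⌈(#Z : ℝ) / r⌉₊ with hq₁
  set q₂ := ⌈(#W : ℝ) / r⌉₊ with hq₂
  have key : ∀ n : ℕ, r ≤ n → 0 < ⌈(n : ℝ) / r⌉₊ ∧ ((⌈(n : ℝ) / r⌉₊ : ℕ) : ℝ) ≤ 2 * (n / r) ∧
      ((n / ⌈(n : ℝ) / r⌉₊ : ℕ) : ℝ) ≤ r := by
    intro n hn
    have hpos : 0 < (n : ℝ) / r := div_pos (by linarith) hr0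
    have h1 : 1 ≤ (n : ℝ) / r := by rwa [le_div_iff₀ hr0, one_mul]
    refine ⟨Nat.ceil_pos.2 hpos, ?_, ?_⟩
    · have := (Nat.ceil_lt_add_one hpos.le).le
      linarith
    · refine Nat.cast_div_le.trans ?_
      rw [div_le_iff₀ (by exact_mod_cast Nat.ceil_pos.2 hpos)]
      have := Nat.le_ceil ((n : ℝ) / r)
      rw [div_le_iff₀ hr0] at this
      linarith
  obtain ⟨a1, a2, a3⟩ := key _ hZ
  obtain ⟨b1, b2, b3⟩ := key _ hW
  have h := card_incidences_le_cells Z W X Y hY a1 b1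
  have h' : (#(incidences Z W X Y) : ℝ) ≤ N * (((#Z / q₁ : ℕ) : ℝ) + ((#W / q₂ : ℕ) : ℝ) + 1) +
      P * (q₁ * q₂) := by
    rw [hNdef, hPdef]; exact_mod_cast h
  have e1 : N * (((#Z / q₁ : ℕ) : ℝ) + ((#W / q₂ : ℕ) : ℝ) + 1) ≤ N * (3 * r) := by
    gcongr
    linarith
  have e2 : P * ((q₁ : ℝ) * q₂) ≤ P * ((2 * (#Z / r)) * (2 * (#W / r))) := by
    gcongr
  have e3 : P * ((2 * (#Z / r)) * (2 * (#W / r))) = 4 * (r * N) := by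
    have : P * ((2 * (#Z / r)) * (2 * (#W / r))) = 4 * P ^ 2 / r ^ 2 := by
      rw [hPdef]; field_simp; ring
    rw [this, ← hrN]
    field_simp
  linarith

/-- A Szemerédi–Trotter bound for the relation `w * y = z * x + 1`. -/
theorem card_incidences_cube_le (Z W X Y : Finset ℝ) (hZ : ∀ z ∈ Z, z ≠ 0)
    (hW : ∀ w ∈ W, w ≠ 0) (hX : ∀ x ∈ X, x ≠ 0) (hY : ∀ y ∈ Y, y ≠ 0) :
    (#(incidences Z W X Y) : ℝ) ^ 3 ≤ 343 * ((#Z : ℝ) * #W * #X * #Y) ^ 2 := by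
  rcases le_total (#X * #Y) (#Z * #W) with h | h
  · exact card_incidences_cube_le_of_le Z W X Y hX hY h
  · rw [card_incidences_symm]
    refine (card_incidences_cube_le_of_le X Y Z W hZ hW h).trans (le_of_eq ?_)
    ring

end Incidences

/-! ### Pigeonholing level sets with a harmonic loss -/

section Pigeonhole

variable {ι : Type*} [DecidableEq ι]

/-- If `t ^ p * #V ≤ c` whenever `f ≥ t` on `V`, then `∑ f ^ p` exceeds `c` by at most a
harmonic factor. -/
theorem sum_pow_le_mul_harmonic (f : ι → ℝ) (hf : ∀ i, 0 ≤ f i) (p : ℕ) {c : ℝ}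
    (U : Finset ι)
    (h : ∀ V ⊆ U, ∀ t : ℝ, 0 ≤ t → (∀ i ∈ V, t ≤ f i) → t ^ p * #V ≤ c) :
    ∑ i ∈ U, f i ^ p ≤ c * (harmonic #U : ℝ) := by
  induction U using Finset.strongInduction with
  | H U ih =>
    rcases U.eq_empty_or_nonempty with rfl | hU
    · simp
    obtain ⟨i₀, hi₀, hmin⟩ := exists_min_image U f hU
    -- The smallest term is at most `c / #U`; peeling it off repeatedly builds the harmonic sum.
    have h1 := ih (U.erase i₀) (erase_ssubset hi₀)
      fun V hV t ht hVt => h V (hV.trans (erase_subset _ _)) t ht hVt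
    have h2 := h U Subset.rfl (f i₀) (hf i₀) hmin
    have hpos : (0 : ℝ) < #U := by exact_mod_cast hU.card_pos
    rw [← le_div_iff₀ hpos] at h2
    rw [← add_sum_erase U _ hi₀]
    have h3 : (harmonic #U : ℝ) = harmonic #(U.erase i₀) + 1 / #U := by
      obtain ⟨m, hm⟩ : ∃ m, #U = m + 1 := ⟨#U - 1, by have := hU.card_pos; omega⟩
      rw [card_erase_of_mem hi₀, hm, Nat.add_sub_cancel, harmonic_succ]
      push_cast
      simp
    rw [h3, mul_add, mul_one_div]
    linarith

/-- Take the superlevel set maximising threshold to the `p` times size. This plays the role of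
dyadic pigeonholing. -/
theorem exists_subset_sum_pow_le (f : ι → ℝ) (hf : ∀ i, 0 ≤ f i) (p : ℕ) (U : Finset ι) :
    ∃ V ⊆ U, ∃ t : ℝ, 0 ≤ t ∧ (∀ i ∈ V, t ≤ f i) ∧
      ∑ i ∈ U, f i ^ p ≤ t ^ p * #V * (harmonic #U : ℝ) := by
  rcases U.eq_empty_or_nonempty with rfl | hU
  · exact ⟨∅, Subset.rfl, 0, le_rfl, by simp, by simp⟩
  obtain ⟨m, -, hmax⟩ := exists_max_image U (fun m => f m ^ p * (#{i ∈ U | f m ≤ f i} : ℝ)) hU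
  refine ⟨{i ∈ U | f m ≤ f i}, filter_subset _ _, f m, hf m, fun i hi => (mem_filter.1 hi).2, ?_⟩
  refine sum_pow_le_mul_harmonic f hf p U ?_
  intro V hV t ht hVt
  rcases V.eq_empty_or_nonempty with rfl | hVne
  · simpa using mul_nonneg (pow_nonneg (hf m) p) (Nat.cast_nonneg _)
  obtain ⟨j, hj, hjmin⟩ := exists_min_image V f hVne
  refine le_trans ?_ (hmax j (hV hj))
  have h1 : #V ≤ #{i ∈ U | f j ≤ f i} :=
    card_le_card fun i hi => mem_filter.2 ⟨hV hi, hjmin i hi⟩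
  have h2 := hVt j hj
  gcongr
  exact pow_nonneg (hf j) p

theorem harmonic_mono : Monotone harmonic := by
  refine monotone_nat_of_le_succ fun n => ?_
  rw [harmonic_succ]
  have : (0 : ℚ) ≤ (↑(n + 1))⁻¹ := by positivity
  linarith

theorem one_le_harmonic {n : ℕ} (hn : 0 < n) : (1 : ℝ) ≤ harmonic n := by
  have : harmonic 1 ≤ harmonic n := harmonic_mono hn
  rw [show harmonic 1 = 1 by simp [harmonic]] at this
  exact_mod_cast this

end Pigeonhole

/-! ### Hölder inequalities for third moments -/

section Hoelder

variable {ι : Type*}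

/-- Hölder's inequality with exponents `3/2` and `3`. -/
theorem sum_sq_mul_cube_le (s : Finset ι) {f g : ι → ℝ} (hf : ∀ i, 0 ≤ f i) (hg : ∀ i, 0 ≤ g i) :
    (∑ i ∈ s, f i ^ 2 * g i) ^ 3 ≤ (∑ i ∈ s, f i ^ 3) ^ 2 * ∑ i ∈ s, g i ^ 3 := by
  have hpq : (3 / 2 : ℝ).HolderConjugate 3 := by
    rw [Real.holderConjugate_iff]
    norm_num
  have h := Real.inner_le_Lp_mul_Lq_of_nonneg s hpq (f := fun i => f i ^ 2) (g := g)
    (fun i _ => by positivity) (fun i _ => hg i)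
  have e1 : ∀ i, (f i ^ 2) ^ (3 / 2 : ℝ) = f i ^ 3 := by
    intro i
    rw [← Real.rpow_natCast, ← Real.rpow_mul (hf i), ← Real.rpow_natCast]
    norm_num
  have e2 : ∀ i, g i ^ (3 : ℝ) = g i ^ 3 := fun i => by
    rw [← Real.rpow_natCast]
    norm_num
  simp only [e1, e2] at h
  have hF : 0 ≤ ∑ i ∈ s, f i ^ 3 := sum_nonneg fun i _ => pow_nonneg (hf i) 3
  have hG : 0 ≤ ∑ i ∈ s, g i ^ 3 := sum_nonneg fun i _ => pow_nonneg (hg i) 3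
  have h0 : 0 ≤ ∑ i ∈ s, f i ^ 2 * g i :=
    sum_nonneg fun i _ => mul_nonneg (by positivity) (hg i)
  refine (pow_le_pow_left₀ h0 h 3).trans (le_of_eq ?_)
  rw [mul_pow, ← Real.rpow_natCast (_ ^ _), ← Real.rpow_natCast (_ ^ _), ← Real.rpow_mul hF,
    ← Real.rpow_mul hG, ← Real.rpow_natCast (∑ i ∈ s, f i ^ 3)]
  norm_num

/-- Cauchy–Schwarz on `f * g = f^(1/2) * (f^(1/2) g)`, then Hölder. For representation counts the
first moment is trivial and the third moments come from cubic decay. -/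
theorem sum_mul_pow_six_le (s : Finset ι) {f g : ι → ℝ} (hf : ∀ i, 0 ≤ f i)
    (hg : ∀ i, 0 ≤ g i) :
    (∑ i ∈ s, f i * g i) ^ 6 ≤
      (∑ i ∈ s, f i) ^ 3 * (∑ i ∈ s, f i ^ 3) * (∑ i ∈ s, g i ^ 3) ^ 2 := by
  have h1 : (∑ i ∈ s, f i * g i) ^ 2 ≤ (∑ i ∈ s, f i) * ∑ i ∈ s, g i ^ 2 * f i := by
    refine sum_sq_le_sum_mul_sum_of_sq_le_mul s (fun i _ => hf i)
      (fun i _ => mul_nonneg (by positivity) (hf i)) fun i _ => le_of_eq ?_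
    ring
  have h2 := sum_sq_mul_cube_le s hg hf
  have h0 : 0 ≤ ∑ i ∈ s, f i := sum_nonneg fun i _ => hf i
  calc (∑ i ∈ s, f i * g i) ^ 6 = ((∑ i ∈ s, f i * g i) ^ 2) ^ 3 := by ring
    _ ≤ ((∑ i ∈ s, f i) * ∑ i ∈ s, g i ^ 2 * f i) ^ 3 := by gcongr
    _ = (∑ i ∈ s, f i) ^ 3 * (∑ i ∈ s, g i ^ 2 * f i) ^ 3 := by ring
    _ ≤ (∑ i ∈ s, f i) ^ 3 * ((∑ i ∈ s, g i ^ 3) ^ 2 * ∑ i ∈ s, f i ^ 3) := by gcongr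
    _ = _ := by ring

end Hoelder

/-! ### Representation counts and cubic decay -/

section Representations

variable {G : Type*} [CommGroup G] [DecidableEq G]

/-- The number of representations of `z` as a quotient `a / x` with `a ∈ A`, `x ∈ X`. -/
def rep (A X : Finset G) (z : G) : ℕ := #{x ∈ X | z * x ∈ A}

theorem rep_le_right (A X : Finset G) (z : G) : rep A X z ≤ #X := card_filter_le _ _

theorem rep_le_left (A X : Finset G) (z : G) : rep A X z ≤ #A := by
  refine card_le_card_of_injOn (fun x => z * x) ?_ fun x _ y _ h => mul_left_cancel h
  intro x hx
  exact (mem_filter.1 hx).2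

theorem rep_mono_left {A A' : Finset G} (h : A ⊆ A') (X : Finset G) (z : G) :
    rep A X z ≤ rep A' X z :=
  card_le_card fun _ hx => mem_filter.2 ⟨(mem_filter.1 hx).1, h (mem_filter.1 hx).2⟩

theorem sum_rep_le (A X Z : Finset G) : ∑ z ∈ Z, rep A X z ≤ #A * #X := by
  simp only [rep]
  rw [← card_sigma, ← card_product]
  refine card_le_card_of_injOn (fun p => (p.1 * p.2, p.2)) ?_ ?_
  · rintro ⟨z, x⟩ hp
    simp only [coe_sigma, Set.mem_sigma_iff, mem_coe, mem_filter] at hp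
    simp [hp.2.1, hp.2.2]
  · rintro ⟨z, x⟩ _ ⟨z', x'⟩ _ h
    simp only [Prod.mk.injEq] at h
    obtain ⟨h1, rfl⟩ := h
    rw [mul_right_cancel h1]

/-- `A` satisfies cubic decay with constant `α`: for every finite `X`, at most
`α * #X ^ 2 / t ^ 3` elements have at least `t` representations as `a / x`. -/
def IsRich (A : Finset G) (α : ℝ) : Prop :=
  ∀ (X Z : Finset G) (t : ℝ), 0 ≤ t → (∀ z ∈ Z, t ≤ rep A X z) → t ^ 3 * #Z ≤ α * (#X : ℝ) ^ 2

theorem IsRich.mono {A A' : Finset G} {α : ℝ} (h : IsRich A' α) (hA : A ⊆ A') : IsRich A α :=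
  fun X Z t ht hZ => h X Z t ht fun z hz =>
    (hZ z hz).trans (by exact_mod_cast rep_mono_left hA X z)

theorem IsRich.mono_right {A : Finset G} {α β : ℝ} (h : IsRich A α) (hαβ : α ≤ β) :
    IsRich A β :=
  fun X Z t ht hZ => (h X Z t ht hZ).trans (by gcongr)

/-- The trivial decay constant, from `t ≤ #A`, `t ≤ #X` and `t * #Z ≤ #A * #X`. It bounds the range
of dyadic levels needed later. -/
theorem isRich_card_sq (A : Finset G) : IsRich A ((#A : ℝ) ^ 2) := by
  intro X Z t ht hZ
  rcases Z.eq_empty_or_nonempty with rfl | ⟨z, hz⟩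
  · simp; positivity
  have h1 : t ≤ #A := (hZ z hz).trans (by exact_mod_cast rep_le_left A X z)
  have h2 : t ≤ #X := (hZ z hz).trans (by exact_mod_cast rep_le_right A X z)
  have h3 : #Z * t ≤ (#A : ℝ) * #X := by
    calc #Z * t = ∑ z ∈ Z, t := by simp
      _ ≤ ∑ z ∈ Z, (rep A X z : ℝ) := sum_le_sum hZ
      _ ≤ (#A : ℝ) * #X := by exact_mod_cast sum_rep_le A X Z
  calc t ^ 3 * #Z = t * t * (#Z * t) := by ring
    _ ≤ #A * #X * (#A * #X) := by gcongr
    _ = (#A : ℝ) ^ 2 * (#X : ℝ) ^ 2 := by ring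

theorem IsRich.sum_rep_cube_le {A : Finset G} {α Λ : ℝ} (h : IsRich A α) (hα : 0 ≤ α)
    (X Z : Finset G) (hΛ : (harmonic #Z : ℝ) ≤ Λ) :
    ∑ z ∈ Z, (rep A X z : ℝ) ^ 3 ≤ Λ * (α * (#X : ℝ) ^ 2) := by
  refine (sum_pow_le_mul_harmonic (fun z => (rep A X z : ℝ)) (fun _ => by positivity) 3
    (c := α * (#X : ℝ) ^ 2) Z fun V _ t ht hV => h X V t ht hV).trans ?_
  rw [mul_comm]
  gcongr

end Representations

/-! ### Popular products and the count of triples -/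

section Triples

variable {G : Type*} [CommGroup G] [DecidableEq G]

/-- Popular products: most elements of `A` pair up with most of `B` to give popular products. -/
theorem exists_popular {A B : Finset G} (hA : A.Nonempty) (hB : B.Nonempty) :
    ∃ P ⊆ A * B, ∃ A' ⊆ A, 3 * #A ≤ 4 * #A' ∧
      (∀ s ∈ P, #A * #B ≤ 16 * #(A * B) * #{p ∈ A ×ˢ B | p.1 * p.2 = s}) ∧
      ∀ a₁ ∈ A', ∀ a₂ ∈ A', #B ≤ 2 * #{b ∈ B | a₁ * b ∈ P ∧ a₂ * b ∈ P} := by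
  set r : G → ℕ := fun s => #{p ∈ A ×ˢ B | p.1 * p.2 = s} with hr
  set P := {s ∈ A * B | #A * #B ≤ 16 * #(A * B) * r s} with hP
  set deg : G → ℕ := fun a => #{b ∈ B | a * b ∉ P} with hdeg
  set A' := {a ∈ A | 4 * deg a ≤ #B} with hA'
  have hM : 0 < #(A * B) := (hA.mul hB).card_pos
  have hB0 : 0 < #B := hB.card_pos
  have hsum : ∑ a ∈ A, deg a = ∑ s ∈ (A * B) \ P, r s := by
    have h1 : ∑ a ∈ A, deg a = #{p ∈ A ×ˢ B | p.1 * p.2 ∉ P} := by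
      rw [card_filter, sum_product]
      simp_rw [hdeg, card_filter]
    have hmaps : ∀ p ∈ {p ∈ A ×ˢ B | p.1 * p.2 ∉ P}, p.1 * p.2 ∈ (A * B) \ P := by
      intro p hp
      simp only [mem_filter, mem_product] at hp
      exact mem_sdiff.2 ⟨mul_mem_mul hp.1.1 hp.1.2, hp.2⟩
    rw [h1, card_eq_sum_card_fiberwise hmaps]
    refine sum_congr rfl fun s hs => ?_
    rw [filter_filter, hr]
    congr 1
    ext p
    simp only [mem_filter]
    constructor
    · rintro ⟨h, -, h3⟩
      exact ⟨h, h3⟩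
    · rintro ⟨h, rfl⟩
      exact ⟨h, (mem_sdiff.1 hs).2, rfl⟩
  -- Unpopular products account for at most 1/16 of all pairs. By Markov three quarters of `A` have
  -- at most `#B / 4` bad partners, and two such elements together lose at most half of `B`.
  have hbad : 16 * ∑ a ∈ A, deg a ≤ #A * #B := by
    refine Nat.le_of_mul_le_mul_left ?_ hM
    calc #(A * B) * (16 * ∑ a ∈ A, deg a) = ∑ s ∈ (A * B) \ P, 16 * #(A * B) * r s := by
          rw [hsum, ← mul_sum]; ring
      _ ≤ ∑ s ∈ (A * B) \ P, #A * #B := by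
          refine sum_le_sum fun s hs => ?_
          have hs' := mem_sdiff.1 hs
          have h2 : ¬ (#A * #B ≤ 16 * #(A * B) * r s) := fun h =>
            hs'.2 (mem_filter.2 ⟨hs'.1, h⟩)
          exact (not_le.1 h2).le
      _ ≤ #(A * B) * (#A * #B) := by
          rw [sum_const, smul_eq_mul]
          exact Nat.mul_le_mul_right _ (card_le_card sdiff_subset)
  refine ⟨P, filter_subset _ _, A', filter_subset _ _, ?_, fun s hs => (mem_filter.1 hs).2, ?_⟩
  · have h1 : #(A \ A') * #B ≤ 4 * ∑ a ∈ A, deg a := by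
      calc #(A \ A') * #B = ∑ a ∈ A \ A', #B := by rw [sum_const, smul_eq_mul]
        _ ≤ ∑ a ∈ A \ A', 4 * deg a := by
            refine sum_le_sum fun a ha => ?_
            have ha' := mem_sdiff.1 ha
            have h2 : ¬ (4 * deg a ≤ #B) := fun h => ha'.2 (mem_filter.2 ⟨ha'.1, h⟩)
            exact (not_le.1 h2).le
        _ ≤ 4 * ∑ a ∈ A, deg a := by
            rw [mul_sum]
            exact sum_le_sum_of_subset sdiff_subset
    have h2 : 4 * #(A \ A') ≤ #A := by
      refine Nat.le_of_mul_le_mul_right ?_ hB0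
      linarith
    have h3 : #(A \ A') + #A' = #A := card_sdiff_add_card_eq_card (filter_subset _ _)
    omega
  · intro a₁ h₁ a₂ h₂
    have d₁ := (mem_filter.1 h₁).2
    have d₂ := (mem_filter.1 h₂).2
    have hcov : B ⊆ ({b ∈ B | a₁ * b ∈ P ∧ a₂ * b ∈ P} ∪ {b ∈ B | a₁ * b ∉ P}) ∪
        {b ∈ B | a₂ * b ∉ P} := by
      intro b hb
      simp only [mem_union, mem_filter, hb, true_and]
      tauto
    have h := (card_le_card hcov).trans ((card_union_le _ _).trans
      (Nat.add_le_add_right (card_union_le _ _) _))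
    change #B ≤ _ + deg a₁ + deg a₂ at h
    omega

/-- Pairs of triples `(a₁, a₂, b)` giving the same `(a₁ * b, a₂ * b)`. -/
theorem card_collisions_triples_le (A A' B : Finset G) (hA' : A' ⊆ A)
    (T : Finset ((G × G) × G)) (hT : T ⊆ (A' ×ˢ A') ×ˢ B) :
    #{p ∈ T ×ˢ T | (p.1.1.1 * p.1.2, p.1.1.2 * p.1.2) = (p.2.1.1 * p.2.2, p.2.1.2 * p.2.2)} ≤
      ∑ u ∈ B / B, rep A A u ^ 2 * rep B B u := by
  have hcard : ∑ u ∈ B / B, rep A A u ^ 2 * rep B B u =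
      #((B / B).sigma fun u => ({x ∈ A | u * x ∈ A} ×ˢ {x ∈ A | u * x ∈ A}) ×ˢ
        {x ∈ B | u * x ∈ B}) := by
    rw [card_sigma]
    refine sum_congr rfl fun u _ => ?_
    rw [card_product, card_product, sq, rep, rep]
  rw [hcard]
  -- If `(a₁, a₂, b)` and `(c₁, c₂, d)` collide, then `u = d / b` carries `c₁, c₂, b` to `a₁, a₂,
  -- d`.
  refine card_le_card_of_injOn
    (fun p => ⟨p.2.2 / p.1.2, (p.2.1.1, p.2.1.2), p.1.2⟩) ?_ ?_
  all_goals
    have key : ∀ p ∈ {p ∈ T ×ˢ T | (p.1.1.1 * p.1.2, p.1.1.2 * p.1.2) =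
        (p.2.1.1 * p.2.2, p.2.1.2 * p.2.2)}, p.1 ∈ T ∧ p.2 ∈ T ∧
        p.2.2 / p.1.2 * p.2.1.1 = p.1.1.1 ∧ p.2.2 / p.1.2 * p.2.1.2 = p.1.1.2 := by
      intro p hp
      simp only [mem_filter, mem_product, Prod.mk.injEq] at hp
      refine ⟨hp.1.1, hp.1.2, ?_, ?_⟩
      · rw [div_mul_eq_mul_div, div_eq_iff_eq_mul, hp.2.1, mul_comm]
      · rw [div_mul_eq_mul_div, div_eq_iff_eq_mul, hp.2.2, mul_comm]
  · intro p hp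
    obtain ⟨h1, h2, e1, e2⟩ := key p hp
    have h1' := hT h1
    have h2' := hT h2
    simp only [mem_product] at h1' h2'
    simp only [coe_sigma, Set.mem_sigma_iff, mem_coe, mem_product, mem_filter, e1, e2,
      div_mul_cancel]
    exact ⟨div_mem_div h2'.2 h1'.2, ⟨⟨hA' h2'.1.1, hA' h1'.1.1⟩, hA' h2'.1.2, hA' h1'.1.2⟩,
      h1'.2, h2'.2⟩
  · rintro ⟨⟨⟨a₁, a₂⟩, b⟩, ⟨c₁, c₂⟩, d⟩ hp ⟨⟨⟨a₁', a₂'⟩, b'⟩, ⟨c₁', c₂'⟩, d'⟩ hp' h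
    obtain ⟨-, -, e1, e2⟩ := key _ hp
    obtain ⟨-, -, e1', e2'⟩ := key _ hp'
    simp only [Sigma.mk.injEq, heq_eq_eq, Prod.mk.injEq] at h e1 e2 e1' e2' ⊢
    obtain ⟨hu, ⟨rfl, rfl⟩, rfl⟩ := h
    obtain rfl : d = d' := by simpa using hu
    exact ⟨⟨⟨e1.symm.trans e1', e2.symm.trans e2'⟩, rfl⟩, ⟨rfl, rfl⟩, rfl⟩

/-- Popular pairs with quotient in `D`. -/
theorem card_popular_pairs_le (A B P D : Finset G) (m : ℕ) (N : ℕ)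
    (hP : ∀ s ∈ P, N ≤ m * #{p ∈ A ×ˢ B | p.1 * p.2 = s}) :
    N * #{p ∈ P ×ˢ P | p.1 / p.2 ∈ D} ≤
      m * ∑ x ∈ P / B, rep A D x * rep B P x⁻¹ := by
  set S := {p ∈ P ×ˢ P | p.1 / p.2 ∈ D} with hS
  have h1 : N * #S ≤ m * #(S.sigma fun p => {q ∈ A ×ˢ B | q.1 * q.2 = p.1}) := by
    rw [card_sigma, mul_sum, mul_comm, ← smul_eq_mul, ← sum_const]
    exact sum_le_sum fun p hp => hP _ (mem_product.1 (mem_filter.1 hp).1).1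
  refine h1.trans (Nat.mul_le_mul_left _ ?_)
  have hcard : ∑ x ∈ P / B, rep A D x * rep B P x⁻¹ =
      #((P / B).sigma fun x => {d ∈ D | x * d ∈ A} ×ˢ {s ∈ P | x⁻¹ * s ∈ B}) := by
    rw [card_sigma]
    refine sum_congr rfl fun u _ => ?_
    rw [card_product, rep, rep]
  rw [hcard]
  -- For `s = a b` put `x = s' / b` and `d = s / s'`; then `x d = a` and `x⁻¹ s' = b`.
  refine card_le_card_of_injOn (fun t => ⟨t.1.2 / t.2.2, t.1.1 / t.1.2, t.1.2⟩) ?_ ?_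
  · rintro ⟨⟨s, s'⟩, a, b⟩ ht
    simp only [hS, coe_sigma, Set.mem_sigma_iff, mem_coe, mem_filter, mem_product] at ht ⊢
    obtain ⟨⟨⟨hs, hs'⟩, hd⟩, ⟨ha, hb⟩, rfl⟩ := ht
    refine ⟨div_mem_div hs' hb, ⟨hd, ?_⟩, hs', ?_⟩
    · have : s' / b * (a * b / s') = a := by
        rw [div_mul_div_comm, div_eq_iff_eq_mul]
        ac_rfl
      rwa [this]
    · simpa [div_eq_mul_inv] using hb
  · rintro ⟨⟨s, s'⟩, a, b⟩ ht ⟨⟨s₁, s₁'⟩, a₁, b₁⟩ ht₁ h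
    simp only [coe_sigma, Set.mem_sigma_iff, mem_coe, mem_filter] at ht ht₁
    simp only [Sigma.mk.injEq, heq_eq_eq, Prod.mk.injEq] at h
    obtain ⟨hx, hd, rfl⟩ := h
    obtain rfl : b = b₁ := by simpa using hx
    obtain rfl : s = s₁ := by simpa using hd
    obtain rfl : a = a₁ := mul_right_cancel (ht.2.2.trans ht₁.2.2.symm)
    rfl

/-- Common popular partners give a lower bound for the number of triples with `a₁ / a₂ ∈ D`.
Cauchy–Schwarz for `(a₁ b, a₂ b)`, which has the same quotient, gives the upper bound. -/
theorem card_sq_triples_le (A A' B P D : Finset G) (hA' : A' ⊆ A)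
    (hB : ∀ a₁ ∈ A', ∀ a₂ ∈ A', #B ≤ 2 * #{b ∈ B | a₁ * b ∈ P ∧ a₂ * b ∈ P}) :
    (#B * ∑ d ∈ D, rep A' A' d) ^ 2 ≤
      4 * (#{p ∈ P ×ˢ P | p.1 / p.2 ∈ D} * ∑ u ∈ B / B, rep A A u ^ 2 * rep B B u) := by
  set S := {p ∈ A' ×ˢ A' | p.1 / p.2 ∈ D} with hS
  set T := {q ∈ S ×ˢ B | q.1.1 * q.2 ∈ P ∧ q.1.2 * q.2 ∈ P} with hT
  have h1 : ∑ d ∈ D, rep A' A' d ≤ #S := by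
    simp only [rep]
    rw [← card_sigma]
    refine card_le_card_of_injOn (fun p => (p.1 * p.2, p.2)) ?_ ?_
    · rintro ⟨z, x⟩ hp
      simp only [coe_sigma, Set.mem_sigma_iff, mem_coe, mem_filter] at hp
      simp [hS, hp.2.1, hp.2.2, hp.1]
    · rintro ⟨z, x⟩ _ ⟨z', x'⟩ _ h
      simp only [Prod.mk.injEq] at h
      obtain ⟨h1, rfl⟩ := h
      rw [mul_right_cancel h1]
  have h2 : #B * #S ≤ 2 * #T := by
    have hTS : #T = ∑ p ∈ S, #{b ∈ B | p.1 * b ∈ P ∧ p.2 * b ∈ P} := by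
      rw [hT, card_filter, sum_product]
      simp_rw [card_filter]
    rw [hTS, mul_sum, mul_comm, ← smul_eq_mul, ← sum_const]
    refine sum_le_sum fun p hp => ?_
    have hp' := mem_product.1 (mem_filter.1 hp).1
    exact hB _ hp'.1 _ hp'.2
  have h3 := card_sq_le_card_image_mul_collisions T fun q => (q.1.1 * q.2, q.1.2 * q.2)
  have h4 : #(T.image fun q => (q.1.1 * q.2, q.1.2 * q.2)) ≤ #{p ∈ P ×ˢ P | p.1 / p.2 ∈ D} := by
    refine card_le_card ?_
    intro s hs
    obtain ⟨q, hq, rfl⟩ := mem_image.1 hs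
    simp only [hT, hS, mem_filter, mem_product] at hq ⊢
    refine ⟨hq.2, ?_⟩
    rw [mul_div_mul_right_eq_div]
    exact hq.1.1.2
  have h5 := card_collisions_triples_le A A' B hA' T
    ((filter_subset _ _).trans (product_subset_product_left (filter_subset _ _)))
  calc (#B * ∑ d ∈ D, rep A' A' d) ^ 2 ≤ (2 * #T) ^ 2 :=
        Nat.pow_le_pow_left ((Nat.mul_le_mul_left _ h1).trans h2) 2
    _ = 4 * #T ^ 2 := by ring
    _ ≤ _ := by
        gcongr
        exact h3.trans (Nat.mul_le_mul h4 h5)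

end Triples

/-! ### Energy bounds and the exponent 41/38 -/

section Energy

variable {G : Type*} [CommGroup G] [DecidableEq G]

/-- The elimination behind the energy bound: `a, b, M, d` are the sizes of `A`, `B`, `A * B` and a
set `D` of quotients with at least `t` representations. `X` counts popular pairs with quotient in
`D`, `Q` and `Y` are representation sums, and `E` is the energy. -/
theorem energy_pow_le_of_bounds {a b M t d α β Λ X Q Y E : ℝ} (ha : 0 < a) (hb : 0 < b)
    (ht : 0 ≤ t) (hd : 0 ≤ d) (hα : 0 ≤ α) (hΛ : 0 ≤ Λ) (hX : 0 ≤ X) (hQ : 0 ≤ Q) (hE : 0 ≤ E)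
    (h1 : (b * (t * d)) ^ 2 ≤ 4 * (X * Q)) (h2 : a * b * X ≤ 16 * M * Y)
    (h3 : Y ^ 6 ≤ (a * d) ^ 3 * (Λ * (α * d ^ 2)) * (Λ * (β * M ^ 2)) ^ 2)
    (h4 : Q ^ 3 ≤ (Λ * (α * a ^ 2)) ^ 2 * (Λ * (β * b ^ 2)))
    (h5 : t ^ 3 * d ≤ α * a ^ 2) (h6 : E ≤ t ^ 2 * d * Λ) :
    E ^ 9 * b ^ 14 ≤ 2 ^ 36 * Λ ^ 18 * M ^ 10 * a ^ 9 * α ^ 7 * β ^ 4 := by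
  rcases hd.eq_or_lt with rfl | hd
  · have : E = 0 := le_antisymm (by simpa using h6) hE
    rw [this]
    simp only [ne_eq, OfNat.ofNat_ne_zero, not_false_eq_true, zero_pow, zero_mul]
    positivity
  have key : t ^ 12 * d ^ 7 * b ^ 14 ≤ 2 ^ 36 * Λ ^ 9 * M ^ 10 * a ^ 5 * α ^ 5 * β ^ 4 := by
    have hpos : 0 < b ^ 4 * a ^ 6 * d ^ 5 := by positivity
    refine le_of_mul_le_mul_right ?_ hpos
    calc t ^ 12 * d ^ 7 * b ^ 14 * (b ^ 4 * a ^ 6 * d ^ 5)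
        = ((b * (t * d)) ^ 2) ^ 6 * (a * b) ^ 6 := by ring
      _ ≤ (4 * (X * Q)) ^ 6 * (a * b) ^ 6 := by gcongr
      _ = 4 ^ 6 * (a * b * X) ^ 6 * (Q ^ 3) ^ 2 := by ring
      _ ≤ 4 ^ 6 * (16 * M * Y) ^ 6 *
          ((Λ * (α * a ^ 2)) ^ 2 * (Λ * (β * b ^ 2))) ^ 2 := by gcongr
      _ = 4 ^ 6 * (16 * M) ^ 6 * Y ^ 6 *
          ((Λ * (α * a ^ 2)) ^ 2 * (Λ * (β * b ^ 2))) ^ 2 := by ring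
      _ ≤ 4 ^ 6 * (16 * M) ^ 6 * ((a * d) ^ 3 * (Λ * (α * d ^ 2)) * (Λ * (β * M ^ 2)) ^ 2) *
          ((Λ * (α * a ^ 2)) ^ 2 * (Λ * (β * b ^ 2))) ^ 2 := by gcongr
      _ = _ := by ring
  calc E ^ 9 * b ^ 14 ≤ (t ^ 2 * d * Λ) ^ 9 * b ^ 14 := by gcongr
    -- The ninth power is chosen so that what remains beside `t^12 d^7` is a power of `t^3 d`, which
    -- cubic decay controls.
    _ = t ^ 12 * d ^ 7 * b ^ 14 * (t ^ 3 * d) ^ 2 * Λ ^ 9 := by ring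
    _ ≤ 2 ^ 36 * Λ ^ 9 * M ^ 10 * a ^ 5 * α ^ 5 * β ^ 4 * (α * a ^ 2) ^ 2 * Λ ^ 9 := by gcongr
    _ = _ := by ring

theorem harmonic_le_of_card_le {N : ℕ} {Λ : ℝ} (hΛ : (harmonic N : ℝ) ≤ Λ) {ι : Type*}
    {S : Finset ι} (hS : #S ≤ N) : (harmonic #S : ℝ) ≤ Λ :=
  le_trans (by exact_mod_cast harmonic_mono hS) hΛ

/-- A large subset of `A` has small quotient energy when `A * B` is small. -/
theorem exists_subset_energy_pow_le {A B : Finset G} (hA : A.Nonempty) (hB : B.Nonempty)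
    {α β Λ : ℝ} (hα : 0 ≤ α) (hβ : 0 ≤ β) (hRA : IsRich A α) (hRB : IsRich B β)
    (hΛ : (harmonic ((#A * #B) ^ 2) : ℝ) ≤ Λ) :
    ∃ A' ⊆ A, 3 * #A ≤ 4 * #A' ∧ ∀ R : Finset G, #R ≤ (#A * #B) ^ 2 →
      (∑ d ∈ R, (rep A' A' d : ℝ) ^ 2) ^ 9 * (#B : ℝ) ^ 14 ≤
        2 ^ 36 * Λ ^ 18 * (#(A * B) : ℝ) ^ 10 * (#A : ℝ) ^ 9 * α ^ 7 * β ^ 4 := by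
  obtain ⟨P, hPAB, A', hA', hcard, hP, hcommon⟩ := exists_popular hA hB
  refine ⟨A', hA', hcard, fun R hR => ?_⟩
  obtain ⟨D, hDR, t, ht, hDt, hE⟩ :=
    exists_subset_sum_pow_le (fun d => (rep A' A' d : ℝ)) (fun _ => Nat.cast_nonneg _) 2 R
  have ha1 : 1 ≤ #A := hA.card_pos
  have hb1 : 1 ≤ #B := hB.card_pos
  have hab1 : 1 ≤ #A * #B := Nat.mul_pos ha1 hb1
  have hΛ0 : 0 ≤ Λ := by
    have := one_le_harmonic (Nat.pow_pos (n := 2) hab1)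
    linarith
  have hPB : #(P / B) ≤ (#A * #B) ^ 2 := by
    calc #(P / B) ≤ #P * #B := card_div_le
      _ ≤ (#A * #B) * (#A * #B) :=
          Nat.mul_le_mul ((card_le_card hPAB).trans card_mul_le)
            (Nat.le_mul_of_pos_left _ ha1)
      _ = _ := (sq _).symm
  have hBB : #(B / B) ≤ (#A * #B) ^ 2 := by
    calc #(B / B) ≤ #B * #B := card_div_le
      _ ≤ (#A * #B) * (#A * #B) :=
          Nat.mul_le_mul (Nat.le_mul_of_pos_left _ ha1) (Nat.le_mul_of_pos_left _ ha1)
      _ = _ := (sq _).symm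
  have hsumD : t * #D ≤ ∑ d ∈ D, (rep A' A' d : ℝ) := by
    calc t * #D = ∑ d ∈ D, t := by simp [mul_comm]
      _ ≤ _ := sum_le_sum hDt
  refine energy_pow_le_of_bounds (t := t) (d := #D)
    (X := #{p ∈ P ×ˢ P | p.1 / p.2 ∈ D})
    (Q := ∑ u ∈ B / B, (rep A A u : ℝ) ^ 2 * rep B B u)
    (Y := ∑ x ∈ P / B, (rep A D x : ℝ) * rep B P x⁻¹)
    (by exact_mod_cast ha1) (by exact_mod_cast hb1) ht (by positivity) hα hΛ0 (by positivity)
    (by positivity) (by positivity) ?_ ?_ ?_ ?_ ?_ ?_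
  · have h := card_sq_triples_le A A' B P D hA' hcommon
    have h' : ((#B : ℝ) * ∑ d ∈ D, (rep A' A' d : ℝ)) ^ 2 ≤
        4 * (#{p ∈ P ×ˢ P | p.1 / p.2 ∈ D} * ∑ u ∈ B / B, (rep A A u : ℝ) ^ 2 * rep B B u) := by
      exact_mod_cast h
    refine le_trans ?_ h'
    gcongr
  · exact_mod_cast card_popular_pairs_le A B P D (16 * #(A * B)) (#A * #B) hP
  · refine (sum_mul_pow_six_le (P / B) (f := fun x => (rep A D x : ℝ))
      (g := fun x => (rep B P x⁻¹ : ℝ)) (fun _ => Nat.cast_nonneg _)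
      (fun _ => Nat.cast_nonneg _)).trans ?_
    have e1 : ∑ x ∈ P / B, (rep A D x : ℝ) ≤ #A * #D := by
      exact_mod_cast sum_rep_le A D (P / B)
    have e2 := hRA.sum_rep_cube_le hα D (P / B) (harmonic_le_of_card_le hΛ hPB)
    have e3 : ∑ x ∈ P / B, (rep B P x⁻¹ : ℝ) ^ 3 ≤ Λ * (β * (#(A * B) : ℝ) ^ 2) := by
      have e4 := hRB.sum_rep_cube_le hβ P (P / B)⁻¹
        (harmonic_le_of_card_le hΛ ((card_inv _).le.trans hPB))
      have e5 : ∑ x ∈ P / B, (rep B P x⁻¹ : ℝ) ^ 3 = ∑ x ∈ (P / B)⁻¹, (rep B P x : ℝ) ^ 3 := by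
        rw [← Finset.image_inv_eq_inv, sum_image fun x _ y _ h => inv_injective h]
      rw [e5]
      refine e4.trans ?_
      have : (#P : ℝ) ≤ #(A * B) := by exact_mod_cast card_le_card hPAB
      gcongr
    gcongr
  · refine (sum_sq_mul_cube_le (B / B) (f := fun x => (rep A A x : ℝ))
      (g := fun x => (rep B B x : ℝ)) (fun _ => Nat.cast_nonneg _)
      (fun _ => Nat.cast_nonneg _)).trans ?_
    have e2 := hRA.sum_rep_cube_le hα A (B / B) (harmonic_le_of_card_le hΛ hBB)
    have e3 := hRB.sum_rep_cube_le hβ B (B / B) (harmonic_le_of_card_le hΛ hBB)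
    gcongr
  · refine (hRA.mono hA' A' D t ht hDt).trans ?_
    have : (#A' : ℝ) ≤ #A := by exact_mod_cast card_le_card hA'
    gcongr
  · refine hE.trans ?_
    have := harmonic_le_of_card_le hΛ hR
    gcongr

/-- Cauchy–Schwarz lower bound for the quotient energies of `A` and `B`. -/
theorem card_mul_card_pow_four_le (A B : Finset G) :
    ((#A : ℝ) * #B) ^ 4 ≤ (#(A * B) : ℝ) ^ 2 *
      ((∑ d ∈ A / A, (rep A A d : ℝ) ^ 2) * ∑ d ∈ A / A, (rep B B d : ℝ) ^ 2) := by
  have h1 := card_sq_le_card_image_mul_collisions (A ×ˢ B) fun p => p.1 * p.2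
  have h2 : #{p ∈ (A ×ˢ B) ×ˢ (A ×ˢ B) | p.1.1 * p.1.2 = p.2.1 * p.2.2} ≤
      ∑ d ∈ A / A, rep A A d * rep B B d := by
    have hcard : ∑ d ∈ A / A, rep A A d * rep B B d =
        #((A / A).sigma fun d => {x ∈ A | d * x ∈ A} ×ˢ {x ∈ B | d * x ∈ B}) := by
      rw [card_sigma]
      refine sum_congr rfl fun u _ => ?_
      rw [card_product, rep, rep]
    rw [hcard]
    refine card_le_card_of_injOn (fun p => ⟨p.1.1 / p.2.1, p.2.1, p.1.2⟩) ?_ ?_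
    all_goals
      have key : ∀ p ∈ {p ∈ (A ×ˢ B) ×ˢ (A ×ˢ B) | p.1.1 * p.1.2 = p.2.1 * p.2.2},
          p ∈ (A ×ˢ B) ×ˢ (A ×ˢ B) ∧ p.1.1 / p.2.1 * p.1.2 = p.2.2 := by
        intro p hp
        have hp' := mem_filter.1 hp
        refine ⟨hp'.1, ?_⟩
        rw [div_mul_eq_mul_div, div_eq_iff_eq_mul, hp'.2, mul_comm]
    · intro p hp
      obtain ⟨hm, e⟩ := key p hp
      simp only [mem_product] at hm
      simp only [coe_sigma, Set.mem_sigma_iff, mem_coe, mem_product, mem_filter, e,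
        div_mul_cancel]
      exact ⟨div_mem_div hm.1.1 hm.2.1, ⟨hm.2.1, hm.1.1⟩, hm.1.2, hm.2.2⟩
    · rintro ⟨⟨a, b⟩, c, d⟩ hp ⟨⟨a', b'⟩, c', d'⟩ hp' h
      obtain ⟨-, e⟩ := key _ hp
      obtain ⟨-, e'⟩ := key _ hp'
      simp only [Sigma.mk.injEq, heq_eq_eq, Prod.mk.injEq] at h e e' ⊢
      obtain ⟨hu, rfl, rfl⟩ := h
      obtain rfl : a = a' := by simpa using hu
      exact ⟨⟨rfl, rfl⟩, rfl, e.symm.trans e'⟩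
  have h3 : ((#A : ℝ) * #B) ^ 2 ≤ #(A * B) * ∑ d ∈ A / A, (rep A A d : ℝ) * rep B B d := by
    have h4 : #((A ×ˢ B).image fun p => p.1 * p.2) = #(A * B) := rfl
    rw [h4, card_product] at h1
    exact_mod_cast h1.trans (Nat.mul_le_mul_left _ h2)
  calc ((#A : ℝ) * #B) ^ 4 = (((#A : ℝ) * #B) ^ 2) ^ 2 := by ring
    _ ≤ (#(A * B) * ∑ d ∈ A / A, (rep A A d : ℝ) * rep B B d) ^ 2 := by gcongr
    _ = (#(A * B) : ℝ) ^ 2 * (∑ d ∈ A / A, (rep A A d : ℝ) * rep B B d) ^ 2 := by ring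
    _ ≤ _ := by
        gcongr
        exact sum_mul_sq_le_sq_mul_sq _ _ _

/-- Lower bound for `A * B` in terms of the cubic decay constants of `A` and `B`. -/
theorem card_mul_card_pow_le {A B : Finset G} (hA : A.Nonempty) (hB : B.Nonempty)
    {α β Λ : ℝ} (hα : 0 ≤ α) (hβ : 0 ≤ β) (hRA : IsRich A α) (hRB : IsRich B β)
    (hΛ : (harmonic ((#A * #B) ^ 2) : ℝ) ≤ Λ) :
    ((#A : ℝ) * #B) ^ 41 ≤ 2 ^ 108 * Λ ^ 36 * (#(A * B) : ℝ) ^ 38 * (α * β) ^ 11 := by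
  obtain ⟨A', hA', hcA, hEA⟩ := exists_subset_energy_pow_le hA hB hα hβ hRA hRB hΛ
  obtain ⟨B', hB', hcB, hEB⟩ := exists_subset_energy_pow_le (Λ := Λ) hB hA hβ hα hRB hRA
    (by rwa [mul_comm #B])
  have ha1 : 0 < #A := hA.card_pos
  have hb1 : 0 < #B := hB.card_pos
  have hR : #(A' / A') ≤ (#A * #B) ^ 2 := by
    calc #(A' / A') ≤ #A' * #A' := card_div_le
      _ ≤ (#A * #B) * (#A * #B) :=
          Nat.mul_le_mul ((card_le_card hA').trans (Nat.le_mul_of_pos_right _ hb1))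
            ((card_le_card hA').trans (Nat.le_mul_of_pos_right _ hb1))
      _ = _ := (sq _).symm
  -- Cauchy–Schwarz needs both energies over the same quotients, hence the free range `R` in the
  -- energy bound.
  replace hEA := hEA (A' / A') hR
  replace hEB := hEB (A' / A') (by rwa [mul_comm #B])
  have hlow := card_mul_card_pow_four_le A' B'
  have hM' : (#(A' * B') : ℝ) ≤ #(A * B) := by
    exact_mod_cast card_le_card (mul_subset_mul hA' hB')
  rw [mul_comm B A] at hEB
  set EA := ∑ d ∈ A' / A', (rep A' A' d : ℝ) ^ 2
  set EB := ∑ d ∈ A' / A', (rep B' B' d : ℝ) ^ 2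
  have hEA0 : 0 ≤ EA := by positivity
  have hEB0 : 0 ≤ EB := by positivity
  set a : ℝ := (#A : ℝ) with ha
  set b : ℝ := (#B : ℝ) with hb
  set M : ℝ := (#(A * B) : ℝ)
  have ha0 : 0 < a := Nat.cast_pos.2 ha1
  have hb0 : 0 < b := Nat.cast_pos.2 hb1
  have hΛ0 : 0 ≤ Λ := by
    have := one_le_harmonic (Nat.pow_pos (n := 2) (Nat.mul_pos ha1 hb1))
    linarith
  have hab : a * b / 2 ≤ #A' * #B' := by
    have h1 : 3 * a ≤ 4 * #A' := by rw [ha]; exact_mod_cast hcA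
    have h2 : 3 * b ≤ 4 * #B' := by rw [hb]; exact_mod_cast hcB
    have h3 : 3 / 4 * a * (3 / 4 * b) ≤ #A' * #B' := by
      gcongr <;> linarith
    nlinarith [mul_pos ha0 hb0]
  have h36 : (a * b) ^ 36 ≤ 2 ^ 36 * (M ^ 18 * (EA ^ 9 * EB ^ 9)) := by
    calc (a * b) ^ 36 = 2 ^ 36 * ((a * b / 2) ^ 4) ^ 9 := by ring
      _ ≤ 2 ^ 36 * (((#A' : ℝ) * #B') ^ 4) ^ 9 := by gcongr
      _ ≤ 2 ^ 36 * ((#(A' * B') : ℝ) ^ 2 * (EA * EB)) ^ 9 := by gcongr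
      _ ≤ 2 ^ 36 * (M ^ 2 * (EA * EB)) ^ 9 := by gcongr
      _ = _ := by ring
  have hpos : 0 < (a * b) ^ 9 := by positivity
  refine le_of_mul_le_mul_right ?_ hpos
  calc (a * b) ^ 41 * (a * b) ^ 9 = (a * b) ^ 36 * (a * b) ^ 14 := by ring
    _ ≤ 2 ^ 36 * (M ^ 18 * (EA ^ 9 * EB ^ 9)) * (a * b) ^ 14 := by gcongr
    _ = 2 ^ 36 * M ^ 18 * ((EA ^ 9 * b ^ 14) * (EB ^ 9 * a ^ 14)) := by ring
    _ ≤ 2 ^ 36 * M ^ 18 * ((2 ^ 36 * Λ ^ 18 * M ^ 10 * a ^ 9 * α ^ 7 * β ^ 4) *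
        (2 ^ 36 * Λ ^ 18 * M ^ 10 * b ^ 9 * β ^ 7 * α ^ 4)) := by gcongr
    _ = _ := by ring

end Energy

/-! ### Making the decay constants of the two images reciprocal -/

section Regularisation

variable {G : Type*} [CommGroup G] [DecidableEq G] {ι : Type*}

/-- The number of representations of `g` as a product `z * x` with `z ∈ Z`, `x ∈ X`. -/
def mulRep (Z X : Finset G) (g : G) : ℕ := #{p ∈ Z ×ˢ X | p.1 * p.2 = g}

theorem sum_mulRep_eq_sum_rep {φ : ι → G} (hφ : Function.Injective φ) (U : Finset ι)
    (Z X : Finset G) :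
    ∑ i ∈ U, mulRep Z X (φ i) = ∑ z ∈ Z, rep (U.image φ) X z := by
  rw [← sum_image (s := U) (g := φ) (f := fun g => mulRep Z X g) fun _ _ _ _ h => hφ h]
  have h1 : ∑ z ∈ Z, rep (U.image φ) X z = #{p ∈ Z ×ˢ X | p.1 * p.2 ∈ U.image φ} := by
    rw [card_filter, sum_product]
    simp_rw [rep, card_filter]
  have hmaps : ∀ p ∈ {p ∈ Z ×ˢ X | p.1 * p.2 ∈ U.image φ}, p.1 * p.2 ∈ U.image φ :=
    fun p hp => (mem_filter.1 hp).2
  rw [h1, card_eq_sum_card_fiberwise hmaps]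
  refine sum_congr rfl fun g hg => ?_
  rw [filter_filter, mulRep]
  congr 1
  ext p
  simp only [mem_filter]
  constructor
  · rintro ⟨h, rfl⟩
    exact ⟨h, hg, rfl⟩
  · rintro ⟨h, -, h3⟩
    exact ⟨h, h3⟩

theorem mul_card_le_sum_mulRep {φ : ι → G} (hφ : Function.Injective φ) (U : Finset ι)
    (Z X : Finset G) {t : ℝ} (ht : ∀ z ∈ Z, t ≤ rep (U.image φ) X z) :
    t * #Z ≤ ∑ i ∈ U, (mulRep Z X (φ i) : ℝ) := by
  calc t * #Z = ∑ z ∈ Z, t := by simp [mul_comm]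
    _ ≤ ∑ z ∈ Z, (rep (U.image φ) X z : ℝ) := sum_le_sum ht
    _ = _ := by exact_mod_cast (sum_mulRep_eq_sum_rep hφ U Z X).symm

/-- A Szemerédi–Trotter type bound linking the two embeddings `φ` and `ψ`. -/
def IncidenceBound (φ ψ : ι → G) : Prop :=
  ∀ (U : Finset ι) (Z X W Y : Finset G),
    (∑ i ∈ U, (mulRep Z X (φ i) : ℝ) * mulRep W Y (ψ i)) ^ 3 ≤
      343 * ((#Z : ℝ) * #X * (#W * #Y)) ^ 2

/-- The cubic decay constant of `U.image φ`, up to a factor of two, with an extremal witness. -/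
theorem exists_dyadic_isRich {φ : ι → G} (hφ : Function.Injective φ) {U : Finset ι}
    (hU : U.Nonempty) {J : ℕ} (hJ : #U ^ 2 ≤ 2 ^ J) :
    ∃ j ≤ J, IsRich (U.image φ) (2 ^ j) ∧ ∃ (X Z : Finset G) (t : ℝ), 0 ≤ t ∧
      (∀ z ∈ Z, t ≤ rep (U.image φ) X z) ∧ 2 ^ j * (#X : ℝ) ^ 2 ≤ 2 * (t ^ 3 * #Z) ∧
      0 < t ^ 3 * #Z := by
  classical
  have hex : ∃ j : ℕ, IsRich (U.image φ) (2 ^ j) := by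
    refine ⟨J, (isRich_card_sq _).mono_right ?_⟩
    rw [card_image_of_injective U hφ]
    exact_mod_cast hJ
  refine ⟨Nat.find hex, Nat.find_min' hex ?_, Nat.find_spec hex, ?_⟩
  · refine (isRich_card_sq _).mono_right ?_
    rw [card_image_of_injective U hφ]
    exact_mod_cast hJ
  have hU1 : (1 : ℝ) ≤ #U := by exact_mod_cast hU.card_pos
  -- At level 0 a one-point `X` is a witness. Otherwise the failure of the previous level provides
  -- one, at the cost of a factor 2.
  rcases Nat.eq_zero_or_pos (Nat.find hex) with h0 | h0
  · refine ⟨{1}, U.image φ, 1, zero_le_one, ?_, ?_, ?_⟩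
    · intro z hz
      have : rep (U.image φ) {1} z = 1 := by
        rw [rep, filter_true_of_mem] <;> simp_all
      simp [this]
    · rw [h0, card_image_of_injective U hφ]
      simp
      linarith
    · rw [card_image_of_injective U hφ]
      linarith
  · have hn := Nat.find_min hex (m := Nat.find hex - 1) (by omega)
    simp only [IsRich, not_forall, not_le] at hn
    obtain ⟨X, Z, t, ht, hZ, hlt⟩ := hn
    refine ⟨X, Z, t, ht, hZ, ?_, lt_of_le_of_lt (by positivity) hlt⟩
    have h2 : (2 : ℝ) ^ Nat.find hex = 2 * 2 ^ (Nat.find hex - 1) := by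
      rw [← pow_succ', Nat.sub_add_cancel h0]
    rw [h2, mul_assoc]
    exact mul_le_mul_of_nonneg_left hlt.le zero_le_two

/-- The average bound for representation counts over a class of level `j`. -/
noncomputable def levelBound {G : Type*} (Λ : ℝ) (j : ℕ) (W Y : Finset G) : ℝ :=
  (686 * Λ ^ 3 * ((#W : ℝ) * #Y) ^ 2 / 2 ^ j) ^ ((1 : ℝ) / 3)

theorem levelBound_nonneg {G : Type*} {Λ : ℝ} (hΛ : 0 ≤ Λ) (j : ℕ) (W Y : Finset G) :
    0 ≤ levelBound Λ j W Y :=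
  Real.rpow_nonneg (by positivity) _

theorem levelBound_cube {G : Type*} {Λ : ℝ} (hΛ : 0 ≤ Λ) (j : ℕ) (W Y : Finset G) :
    levelBound Λ j W Y ^ 3 = 686 * Λ ^ 3 * ((#W : ℝ) * #Y) ^ 2 / 2 ^ j := by
  rw [levelBound, ← Real.rpow_natCast, ← Real.rpow_mul (by positivity)]
  norm_num

variable [DecidableEq ι]

/-- The extremal witness gives total count at least `t * #Z` over `U`. Pigeonholing finds `V` on
which every count is at least `κ`, with `κ * #V` of that order. Since `κ` times the sum for `ψ` is
bounded by incidences, the average for `ψ` over `V` is small. -/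
theorem exists_regular_subset {φ ψ : ι → G} (hφ : Function.Injective φ)
    (hinc : IncidenceBound φ ψ) {U : Finset ι} (hU : U.Nonempty) {J : ℕ}
    (hJ : #U ^ 2 ≤ 2 ^ J) {Λ : ℝ} (hΛ : (harmonic #U : ℝ) ≤ Λ) :
    ∃ V ⊆ U, V.Nonempty ∧ ∃ j ≤ J, IsRich (U.image φ) (2 ^ j) ∧
      ∀ W Y : Finset G, ∑ i ∈ V, (mulRep W Y (ψ i) : ℝ) ≤ #V * levelBound Λ j W Y := by
  have hΛ0 : 0 ≤ Λ := by
    have := one_le_harmonic hU.card_pos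
    linarith
  obtain ⟨j, hj, hrich, X, Z, t, ht, hZ, hX, hpos⟩ := exists_dyadic_isRich hφ hU hJ
  obtain ⟨V, hVU, κ, hκ, hVκ, hsum⟩ :=
    exists_subset_sum_pow_le (fun i => (mulRep Z X (φ i) : ℝ)) (fun _ => Nat.cast_nonneg _) 1 U
  simp only [pow_one] at hsum
  have hZ0 : (0 : ℝ) < #Z := by
    by_contra h
    have : (#Z : ℝ) = 0 := le_antisymm (not_lt.1 h) (Nat.cast_nonneg _)
    simp [this] at hpos
  have ht0 : 0 < t := by
    rcases ht.eq_or_lt with rfl | h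
    · simp at hpos
    · exact h
  have h1 : t * #Z ≤ κ * #V * Λ :=
    (mul_card_le_sum_mulRep hφ U Z X hZ).trans (hsum.trans (by gcongr))
  refine ⟨V, hVU, ?_, j, hj, hrich, fun W Y => ?_⟩
  · rw [nonempty_iff_ne_empty]
    rintro rfl
    have : 0 < t * #Z := by positivity
    simp at h1
    linarith
  set s := ∑ i ∈ V, (mulRep W Y (ψ i) : ℝ) with hs
  have hs0 : 0 ≤ s := by positivity
  have h2 : (κ * s) ^ 3 ≤ 343 * ((#Z : ℝ) * #X * (#W * #Y)) ^ 2 := by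
    refine le_trans ?_ (hinc V Z X W Y)
    gcongr
    rw [hs, mul_sum]
    refine sum_le_sum fun i hi => ?_
    have := hVκ i hi
    gcongr
  refine le_of_pow_le_pow_left₀ three_ne_zero
    (mul_nonneg (by positivity) (levelBound_nonneg hΛ0 j W Y)) ?_
  rw [mul_pow, levelBound_cube hΛ0, ← mul_div_assoc, le_div_iff₀ (by positivity)]
  have hcancel : 0 < t ^ 3 * (#Z : ℝ) ^ 3 := by positivity
  refine le_of_mul_le_mul_right ?_ hcancel
  calc s ^ 3 * 2 ^ j * (t ^ 3 * (#Z : ℝ) ^ 3) = s ^ 3 * (t * #Z) ^ 3 * 2 ^ j := by ring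
    _ ≤ s ^ 3 * (κ * #V * Λ) ^ 3 * 2 ^ j := by gcongr
    _ = (κ * s) ^ 3 * (#V * Λ) ^ 3 * 2 ^ j := by ring
    _ ≤ 343 * ((#Z : ℝ) * #X * (#W * #Y)) ^ 2 * (#V * Λ) ^ 3 * 2 ^ j := by gcongr
    _ = 343 * ((#Z : ℝ) * (#W * #Y)) ^ 2 * (#V * Λ) ^ 3 * (2 ^ j * (#X : ℝ) ^ 2) := by ring
    _ ≤ 343 * ((#Z : ℝ) * (#W * #Y)) ^ 2 * (#V * Λ) ^ 3 * (2 * (t ^ 3 * #Z)) := by gcongr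
    _ = _ := by ring

/-- Remove regular pieces greedily and merge those of equal level. The bound for `ψ` is additive
over disjoint pieces. Decay for `φ` is inherited from the set remaining when the first piece of that
level was removed, which contains all later ones. -/
theorem exists_regular_colouring {φ ψ : ι → G} (hφ : Function.Injective φ)
    (hinc : IncidenceBound φ ψ) {J : ℕ} {Λ : ℝ} (U : Finset ι) (hJ : #U ^ 2 ≤ 2 ^ J)
    (hΛ : (harmonic #U : ℝ) ≤ Λ) :
    ∃ c : ι → ℕ, (∀ i ∈ U, c i ≤ J) ∧ ∀ j,
      IsRich ({i ∈ U | c i = j}.image φ) (2 ^ j) ∧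
      ∀ W Y : Finset G, ∑ i ∈ U with c i = j, (mulRep W Y (ψ i) : ℝ) ≤
        #{i ∈ U | c i = j} * levelBound Λ j W Y := by
  induction U using Finset.strongInduction with
  | H U ih =>
    rcases U.eq_empty_or_nonempty with rfl | hU
    · refine ⟨fun _ => 0, by simp, fun j => ⟨?_, by simp⟩⟩
      refine (isRich_card_sq _).mono_right ?_
      simp
    obtain ⟨V, hVU, hV, j₀, hj₀, hrich, hsum⟩ := exists_regular_subset hφ hinc hU hJ hΛ
    have hle : #(U \ V) ≤ #U := card_le_card sdiff_subset
    obtain ⟨c, hcJ, hc⟩ := ih (U \ V) (sdiff_ssubset hVU hV)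
      ((Nat.pow_le_pow_left hle 2).trans hJ) (harmonic_le_of_card_le hΛ hle)
    refine ⟨fun i => if i ∈ V then j₀ else c i, ?_, fun j => ?_⟩
    · intro i hi
      by_cases hiV : i ∈ V
      · simpa [hiV] using hj₀
      · simpa [hiV] using hcJ i (mem_sdiff.2 ⟨hi, hiV⟩)
    by_cases hj : j = j₀
    · subst hj
      refine ⟨hrich.mono (image_subset_image (filter_subset _ _)), fun W Y => ?_⟩
      have hset : {i ∈ U | (if i ∈ V then j else c i) = j} = V ∪ {i ∈ U \ V | c i = j} := by
        ext i
        by_cases hiV : i ∈ V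
        · simp [hiV, hVU hiV]
        · simp [hiV]
      have hdisj : Disjoint V {i ∈ U \ V | c i = j} :=
        disjoint_sdiff.mono_right (filter_subset _ _)
      rw [hset, sum_union hdisj, card_union_of_disjoint hdisj, Nat.cast_add, add_mul]
      exact add_le_add (hsum W Y) ((hc j).2 W Y)
    · have hset : {i ∈ U | (if i ∈ V then j₀ else c i) = j} = {i ∈ U \ V | c i = j} := by
        ext i
        by_cases hiV : i ∈ V
        · simp [hiV, Ne.symm hj]
        · simp [hiV]
      rw [hset]
      exact hc j

/-- Regularisation: a large subset on which the decay constants of the two images are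
reciprocal up to the incidence bound. -/
theorem exists_subset_isRich_isRich {φ ψ : ι → G} (hφ : Function.Injective φ)
    (hψ : Function.Injective ψ) (hinc : IncidenceBound φ ψ) {U : Finset ι} (hU : U.Nonempty)
    {J : ℕ} (hJ : #U ^ 2 ≤ 2 ^ J) {Λ : ℝ} (hΛ : (harmonic #U : ℝ) ≤ Λ) :
    ∃ V ⊆ U, V.Nonempty ∧ #U ≤ (J + 1) * #V ∧ ∃ α β : ℝ, 0 ≤ α ∧ 0 ≤ β ∧
      IsRich (V.image φ) α ∧ IsRich (V.image ψ) β ∧ α * β = 686 * Λ ^ 3 * (#V : ℝ) ^ 3 := by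
  have hΛ0 : 0 ≤ Λ := by
    have := one_le_harmonic hU.card_pos
    linarith
  obtain ⟨c, hcJ, hc⟩ := exists_regular_colouring hφ hinc U hJ hΛ
  obtain ⟨j, -, hmax⟩ := exists_max_image (range (J + 1)) (fun j => #{i ∈ U | c i = j})
    ⟨0, by simp⟩
  have hmaps : ∀ i ∈ U, c i ∈ range (J + 1) := fun i hi =>
    mem_range.2 (Nat.lt_succ_of_le (hcJ i hi))
  have hcard : #U ≤ (J + 1) * #{i ∈ U | c i = j} := by
    rw [card_eq_sum_card_fiberwise hmaps]
    refine (sum_le_card_nsmul _ _ _ hmax).trans ?_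
    rw [card_range, smul_eq_mul]
  set V := {i ∈ U | c i = j}
  refine ⟨V, filter_subset _ _, ?_, hcard, 2 ^ j, 686 * Λ ^ 3 * (#V : ℝ) ^ 3 / 2 ^ j,
    by positivity, by positivity, (hc j).1, ?_, by field_simp⟩
  · rw [← card_pos]
    have := hU.card_pos
    exact Nat.pos_of_mul_pos_left (this.trans_le hcard)
  intro Y W t ht hW
  -- The averaged bound becomes cubic decay after cubing and cancelling `#W ^ 2`.
  have h1 : t * #W ≤ #V * levelBound Λ j W Y :=
    (mul_card_le_sum_mulRep hψ V W Y hW).trans ((hc j).2 W Y)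
  rcases Nat.eq_zero_or_pos #W with h0 | h0
  · rw [h0, Nat.cast_zero, mul_zero]
    positivity
  have hW0 : (0 : ℝ) < #W := by exact_mod_cast h0
  have h2 : (t * #W) ^ 3 ≤ (#V * levelBound Λ j W Y) ^ 3 := by gcongr
  rw [mul_pow _ (levelBound Λ j W Y), levelBound_cube hΛ0] at h2
  refine le_of_mul_le_mul_right ?_ (pow_pos hW0 2)
  calc t ^ 3 * #W * (#W : ℝ) ^ 2 = (t * #W) ^ 3 := by ring
    _ ≤ _ := h2
    _ = _ := by ring

theorem pow_49_le_of_pow_41_le {u v M₁ M₂ α₁ α₂ β₁ β₂ c K : ℝ} (hu : 0 < u) (hv : 0 < v)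
    (h₁ : (u * v) ^ 41 ≤ c * M₁ ^ 38 * (α₁ * β₁) ^ 11)
    (h₂ : (u * v) ^ 41 ≤ c * M₂ ^ 38 * (α₂ * β₂) ^ 11)
    (hα : α₁ * α₂ = K * u ^ 3) (hβ : β₁ * β₂ = K * v ^ 3) :
    (u * v) ^ 49 ≤ c ^ 2 * K ^ 22 * (M₁ * M₂) ^ 38 := by
  have hpos : 0 < (u * v) ^ 33 := by positivity
  refine le_of_mul_le_mul_right ?_ hpos
  have h41 : 0 ≤ (u * v) ^ 41 := by positivity
  calc (u * v) ^ 49 * (u * v) ^ 33 = (u * v) ^ 41 * (u * v) ^ 41 := by ring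
    _ ≤ (c * M₁ ^ 38 * (α₁ * β₁) ^ 11) * (c * M₂ ^ 38 * (α₂ * β₂) ^ 11) :=
        mul_le_mul h₁ h₂ h41 (h41.trans h₁)
    _ = c ^ 2 * (M₁ * M₂) ^ 38 * ((α₁ * α₂) ^ 11 * (β₁ * β₂) ^ 11) := by ring
    _ = _ := by rw [hα, hβ]; ring

/-- The product of the cardinalities of product sets under two linked embeddings. -/
theorem card_mul_card_pow_49_le {φ ψ : ι → G} (hφ : Function.Injective φ)
    (hψ : Function.Injective ψ) (hinc : IncidenceBound φ ψ) {A B : Finset ι}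
    (hA : A.Nonempty) (hB : B.Nonempty) {J : ℕ} (hJ : (#A * #B) ^ 2 ≤ 2 ^ J) {Λ : ℝ}
    (hΛ : (harmonic ((#A * #B) ^ 2) : ℝ) ≤ Λ) :
    ((#A : ℝ) * #B) ^ 49 ≤ (2 ^ 108 * Λ ^ 36) ^ 2 * (686 * Λ ^ 3) ^ 22 * ((J : ℝ) + 1) ^ 98 *
      ((#(A.image φ * B.image φ) : ℝ) * #(A.image ψ * B.image ψ)) ^ 38 := by
  have ha1 : 0 < #A := hA.card_pos
  have hb1 : 0 < #B := hB.card_pos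
  have hΛ0 : 0 ≤ Λ := by
    have := one_le_harmonic (Nat.pow_pos (n := 2) (Nat.mul_pos ha1 hb1))
    linarith
  have hab : 1 ≤ #A * #B := Nat.mul_pos ha1 hb1
  obtain ⟨U, hUA, hU, hcU, α₁, α₂, hα₁, hα₂, hR₁, hR₂, hα⟩ :=
    exists_subset_isRich_isRich hφ hψ hinc hA (J := J) (Λ := Λ)
      ((Nat.pow_le_pow_left (Nat.le_mul_of_pos_right _ hb1) 2).trans hJ)
      (harmonic_le_of_card_le hΛ ((Nat.le_mul_of_pos_right _ hb1).trans
        (Nat.le_self_pow two_ne_zero _)))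
  obtain ⟨V, hVB, hV, hcV, β₁, β₂, hβ₁, hβ₂, hS₁, hS₂, hβ⟩ :=
    exists_subset_isRich_isRich hφ hψ hinc hB (J := J) (Λ := Λ)
      ((Nat.pow_le_pow_left (Nat.le_mul_of_pos_left _ ha1) 2).trans hJ)
      (harmonic_le_of_card_le hΛ ((Nat.le_mul_of_pos_left _ ha1).trans
        (Nat.le_self_pow two_ne_zero _)))
  have hle : (#U * #V) ^ 2 ≤ (#A * #B) ^ 2 :=
    Nat.pow_le_pow_left (Nat.mul_le_mul (card_le_card hUA) (card_le_card hVB)) 2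
  have hΛ' : (harmonic ((#U * #V) ^ 2) : ℝ) ≤ Λ :=
    le_trans (by exact_mod_cast harmonic_mono hle) hΛ
  have h₁ := card_mul_card_pow_le (hU.image φ) (hV.image φ) hα₁ hβ₁ hR₁ hS₁ (Λ := Λ)
    (by rwa [card_image_of_injective U hφ, card_image_of_injective V hφ])
  have h₂ := card_mul_card_pow_le (hU.image ψ) (hV.image ψ) hα₂ hβ₂ hR₂ hS₂ (Λ := Λ)
    (by rwa [card_image_of_injective U hψ, card_image_of_injective V hψ])
  rw [card_image_of_injective U hφ, card_image_of_injective V hφ] at h₁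
  rw [card_image_of_injective U hψ, card_image_of_injective V hψ] at h₂
  have hM₁ : (#(U.image φ * V.image φ) : ℝ) ≤ #(A.image φ * B.image φ) := by
    exact_mod_cast card_le_card (mul_subset_mul (image_subset_image hUA) (image_subset_image hVB))
  have hM₂ : (#(U.image ψ * V.image ψ) : ℝ) ≤ #(A.image ψ * B.image ψ) := by
    exact_mod_cast card_le_card (mul_subset_mul (image_subset_image hUA) (image_subset_image hVB))
  have hcU' : (#A : ℝ) ≤ ((J : ℝ) + 1) * #U := by exact_mod_cast hcU
  have hcV' : (#B : ℝ) ≤ ((J : ℝ) + 1) * #V := by exact_mod_cast hcV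
  have hu : (0 : ℝ) < #U := by exact_mod_cast hU.card_pos
  have hv : (0 : ℝ) < #V := by exact_mod_cast hV.card_pos
  have hc0 : 0 ≤ 2 ^ 108 * Λ ^ 36 :=
    mul_nonneg (pow_nonneg zero_le_two _) (pow_nonneg hΛ0 _)
  have hK0 : 0 ≤ 686 * Λ ^ 3 := by positivity
  generalize 2 ^ 108 * Λ ^ 36 = c at *
  generalize 686 * Λ ^ 3 = K at *
  have key := pow_49_le_of_pow_41_le hu hv h₁ h₂ hα hβ
  calc ((#A : ℝ) * #B) ^ 49 ≤ (((J : ℝ) + 1) * #U * (((J : ℝ) + 1) * #V)) ^ 49 := by gcongr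
    _ = ((#U : ℝ) * #V) ^ 49 * ((J : ℝ) + 1) ^ 98 := by ring
    _ ≤ c ^ 2 * K ^ 22 *
        ((#(U.image φ * V.image φ) : ℝ) * #(U.image ψ * V.image ψ)) ^ 38 *
        ((J : ℝ) + 1) ^ 98 := by gcongr
    _ ≤ c ^ 2 * K ^ 22 *
        ((#(A.image φ * B.image φ) : ℝ) * #(A.image ψ * B.image ψ)) ^ 38 *
        ((J : ℝ) + 1) ^ 98 := by gcongr
    _ = _ := by ring

end Regularisation

/-! ### Application to real numbers and the shift by 1 -/

section RealNumbers

/-- Real numbers `a` for which both `a` and `a + 1` are invertible. -/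
abbrev ShiftUnit : Type := {a : ℝ // a ≠ 0 ∧ a + 1 ≠ 0}

/-- The unit `a`. -/
noncomputable def ShiftUnit.toUnit (a : ShiftUnit) : ℝˣ := Units.mk0 a.1 a.2.1

/-- The unit `a + 1`. -/
noncomputable def ShiftUnit.succUnit (a : ShiftUnit) : ℝˣ := Units.mk0 (a.1 + 1) a.2.2

theorem ShiftUnit.toUnit_injective : Function.Injective ShiftUnit.toUnit := by
  intro a b h
  have : (a.toUnit : ℝ) = b.toUnit := by rw [h]
  exact Subtype.ext this

theorem ShiftUnit.succUnit_injective : Function.Injective ShiftUnit.succUnit := by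
  intro a b h
  have : (a.succUnit : ℝ) = b.succUnit := by rw [h]
  exact Subtype.ext (add_right_cancel (b := (1 : ℝ)) this)

theorem incidenceBound_shiftUnit : IncidenceBound ShiftUnit.toUnit ShiftUnit.succUnit := by
  intro U Z X W Y
  set v : Finset ℝˣ → Finset ℝ := fun S => S.image Units.val with hv
  have hcard : ∀ S, #(v S) = #S := fun S => card_image_of_injective S Units.val_injective
  have hne : ∀ S, ∀ x ∈ v S, x ≠ 0 := by
    intro S x hx
    obtain ⟨u, -, rfl⟩ := mem_image.1 hx
    exact u.ne_zero
  have h := card_incidences_cube_le (v Z) (v W) (v X) (v Y) (hne Z) (hne W) (hne X) (hne Y)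
  rw [hcard, hcard, hcard, hcard] at h
  have hle : ∑ i ∈ U, mulRep Z X i.toUnit * mulRep W Y i.succUnit ≤
      #(incidences (v Z) (v W) (v X) (v Y)) := by
    simp only [mulRep]
    simp_rw [← card_product]
    rw [← card_sigma]
    refine card_le_card_of_injOn
      (fun t => (((t.2.1.1 : ℝ), (t.2.2.1 : ℝ)), ((t.2.1.2 : ℝ), (t.2.2.2 : ℝ)))) ?_ ?_
    · rintro ⟨i, ⟨z, x⟩, w, y⟩ ht
      simp only [coe_sigma, Set.mem_sigma_iff, mem_coe, mem_product, mem_filter] at ht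
      obtain ⟨-, ⟨⟨hz, hx⟩, h1⟩, ⟨hw, hy⟩, h2⟩ := ht
      have e1 : (z : ℝ) * x = i.1 := by rw [← Units.val_mul, h1]; rfl
      have e2 : (w : ℝ) * y = i.1 + 1 := by rw [← Units.val_mul, h2]; rfl
      simp only [incidences, mem_coe, mem_filter, mem_product]
      exact ⟨⟨⟨mem_image_of_mem _ hz, mem_image_of_mem _ hw⟩, mem_image_of_mem _ hx,
        mem_image_of_mem _ hy⟩, by rw [e1, e2]⟩
    · rintro ⟨i, ⟨z, x⟩, w, y⟩ ht ⟨i', ⟨z', x'⟩, w', y'⟩ ht' h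
      simp only [coe_sigma, Set.mem_sigma_iff, mem_coe, mem_product, mem_filter] at ht ht'
      simp only [Prod.mk.injEq, Units.val_inj] at h
      obtain ⟨⟨rfl, rfl⟩, rfl, rfl⟩ := h
      obtain rfl : i = i' :=
        ShiftUnit.toUnit_injective (ht.2.1.2.symm.trans ht'.2.1.2)
      rfl
  have hle' : ∑ i ∈ U, (mulRep Z X i.toUnit : ℝ) * mulRep W Y i.succUnit ≤
      #(incidences (v Z) (v W) (v X) (v Y)) := by exact_mod_cast hle
  calc (∑ i ∈ U, (mulRep Z X i.toUnit : ℝ) * mulRep W Y i.succUnit) ^ 3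
      ≤ (#(incidences (v Z) (v W) (v X) (v Y)) : ℝ) ^ 3 := by gcongr
    _ ≤ _ := h
    _ = _ := by ring

theorem card_subtype_shiftUnit (A : Finset ℝ) :
    #A ≤ #(A.subtype fun a => a ≠ 0 ∧ a + 1 ≠ 0) + 2 := by
  rw [card_subtype]
  have hsub : A ⊆ {a ∈ A | a ≠ 0 ∧ a + 1 ≠ 0} ∪ {0, -1} := by
    intro a ha
    by_cases h0 : a = 0
    · simp [h0]
    by_cases h1 : a + 1 = 0
    · simp [eq_neg_of_add_eq_zero_left h1]
    · simp [ha, h0, h1]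
  exact (card_le_card hsub).trans ((card_union_le _ _).trans (Nat.add_le_add_left card_le_two _))

theorem card_image_toUnit_mul_le (A B : Finset ℝ) :
    #((A.subtype fun a => a ≠ 0 ∧ a + 1 ≠ 0).image ShiftUnit.toUnit *
      (B.subtype fun a => a ≠ 0 ∧ a + 1 ≠ 0).image ShiftUnit.toUnit) ≤ #(A * B) := by
  refine card_le_card_of_injOn Units.val ?_ (Units.val_injective.injOn)
  intro u hu
  obtain ⟨x, hx, y, hy, rfl⟩ := mem_mul.1 (mem_coe.1 hu)
  obtain ⟨a, ha, rfl⟩ := mem_image.1 hx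
  obtain ⟨b, hb, rfl⟩ := mem_image.1 hy
  rw [Units.val_mul]
  exact mul_mem_mul (mem_subtype.1 ha) (mem_subtype.1 hb)

theorem card_image_succUnit_mul_le (A B : Finset ℝ) :
    #((A.subtype fun a => a ≠ 0 ∧ a + 1 ≠ 0).image ShiftUnit.succUnit *
      (B.subtype fun a => a ≠ 0 ∧ a + 1 ≠ 0).image ShiftUnit.succUnit) ≤
      #((A + {1}) * (B + {1})) := by
  refine card_le_card_of_injOn Units.val ?_ (Units.val_injective.injOn)
  intro u hu
  obtain ⟨x, hx, y, hy, rfl⟩ := mem_mul.1 (mem_coe.1 hu)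
  obtain ⟨a, ha, rfl⟩ := mem_image.1 hx
  obtain ⟨b, hb, rfl⟩ := mem_image.1 hy
  rw [Units.val_mul]
  exact mul_mem_mul (add_mem_add (mem_subtype.1 ha) (mem_singleton_self _))
    (add_mem_add (mem_subtype.1 hb) (mem_singleton_self _))

theorem card_le_card_mul_of_mem {A B : Finset ℝ} {b : ℝ} (hb : b ∈ B) (h0 : b ≠ 0) :
    #A ≤ #(A * B) :=
  card_le_card_of_injOn (fun a => a * b) (fun _ ha => mul_mem_mul ha hb)
    fun _ _ _ _ h => mul_right_cancel₀ h0 h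

/-- Since `b` and `b + 1` are not both zero, one of the two products contains a dilate. This handles
small sets. -/
theorem card_le_card_mul_add_card_shift_mul (A : Finset ℝ) {B : Finset ℝ} (hB : B.Nonempty) :
    #A ≤ #(A * B) + #((A + {1}) * (B + {1})) := by
  obtain ⟨b, hb⟩ := hB
  by_cases h0 : b = 0
  · have h1 : b + 1 ∈ B + {1} := add_mem_add hb (mem_singleton_self _)
    have h2 := card_le_card_mul_of_mem (A := A + {1}) h1 (by rw [h0]; norm_num)
    rw [card_add_singleton] at h2
    omega
  · have := card_le_card_mul_of_mem (A := A) hb h0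
    omega

theorem one_le_log_add_two {n : ℝ} (hn : 1 ≤ n) : 1 ≤ Real.log (n + 2) := by
  rw [Real.le_log_iff_exp_le (by linarith)]
  linarith [Real.exp_one_lt_three]

theorem exists_pow_le_of_four_le_card : ∃ C : ℝ, 0 < C ∧ ∀ A B : Finset ℝ, 4 ≤ #A → 4 ≤ #B →
    ((#A : ℝ) * #B) ^ 49 ≤ C * (Real.log ((#A : ℝ) * #B + 2) ^ 4 *
      ((#(A * B) : ℝ) + #((A + {1}) * (B + {1})))) ^ 76 := by
  obtain ⟨c, hc, hcdef⟩ : ∃ c : ℝ, 0 < c ∧ c = 2 ^ 108 :=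
    ⟨2 ^ 108, pow_pos zero_lt_two _, rfl⟩
  obtain ⟨K, hK, hKdef⟩ : ∃ K : ℝ, 0 < K ∧
      K = (c * 3 ^ 36) ^ 2 * (686 * 3 ^ 3) ^ 22 * 6 ^ 98 := ⟨_, by positivity, rfl⟩
  refine ⟨4 ^ 49 * K, by positivity, fun A B hA hB => ?_⟩
  set A' := A.subtype fun a => a ≠ 0 ∧ a + 1 ≠ 0 with hA'
  set B' := B.subtype fun a => a ≠ 0 ∧ a + 1 ≠ 0 with hB'
  have hcA : #A ≤ #A' + 2 := card_subtype_shiftUnit A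
  have hcB : #B ≤ #B' + 2 := card_subtype_shiftUnit B
  have hleA : #A' ≤ #A := by rw [hA', card_subtype]; exact card_filter_le _ _
  have hleB : #B' ≤ #B := by rw [hB', card_subtype]; exact card_filter_le _ _
  have hA0 : A'.Nonempty := card_pos.1 (by omega)
  have hB0 : B'.Nonempty := card_pos.1 (by omega)
  set N := (#A' * #B') ^ 2 with hN
  have hN0 : N ≠ 0 := by
    have := hA0.card_pos
    have := hB0.card_pos
    positivity
  set L := Real.log ((#A : ℝ) * #B + 2) with hL
  have hA1 : (1 : ℝ) ≤ #A := by exact_mod_cast (by omega : 1 ≤ #A)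
  have hB1 : (1 : ℝ) ≤ #B := by exact_mod_cast (by omega : 1 ≤ #B)
  have hL1 : 1 ≤ L := one_le_log_add_two (one_le_mul_of_one_le_of_one_le hA1 hB1)
  have hlogN : Real.log N ≤ 2 * L := by
    have h1 : (N : ℝ) ≤ ((#A : ℝ) * #B + 2) ^ 2 := by
      rw [hN]
      push_cast
      have hA'' : (#A' : ℝ) ≤ #A := by exact_mod_cast hleA
      have hB'' : (#B' : ℝ) ≤ #B := by exact_mod_cast hleB
      gcongr
      have : (#A' : ℝ) * #B' ≤ #A * #B := by gcongr
      linarith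
    calc Real.log N ≤ Real.log (((#A : ℝ) * #B + 2) ^ 2) :=
          Real.log_le_log (by exact_mod_cast Nat.pos_of_ne_zero hN0) h1
      _ = 2 * L := by rw [Real.log_pow, hL, Nat.cast_ofNat]
  have hΛ : (harmonic N : ℝ) ≤ 3 * L := by
    have := harmonic_le_one_add_log N
    linarith
  set J := Nat.log 2 N + 1 with hJ
  have hNJ : N ≤ 2 ^ J := (Nat.lt_pow_succ_log_self one_lt_two N).le
  -- From `log 2 > 1/2` the binary logarithm of `N` is at most `4 * L`, and the additional 2 is at
  -- most `2 * L`.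
  have hJL : (J : ℝ) + 1 ≤ 6 * L := by
    have h1 : ((2 : ℝ) ^ Nat.log 2 N) ≤ N := by exact_mod_cast Nat.pow_log_le_self 2 hN0
    have h2 := Real.log_le_log (by positivity) h1
    rw [Real.log_pow] at h2
    have h3 := Real.log_two_gt_d9
    have h4 : (Nat.log 2 N : ℝ) * (1 / 2) ≤ Nat.log 2 N * Real.log 2 := by
      gcongr
      linarith
    rw [hJ]
    push_cast
    linarith
  have hmain := card_mul_card_pow_49_le ShiftUnit.toUnit_injective ShiftUnit.succUnit_injective
    incidenceBound_shiftUnit hA0 hB0 hNJ hΛ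
  rw [← hcdef] at hmain
  have hM₁ : (#(A'.image ShiftUnit.toUnit * B'.image ShiftUnit.toUnit) : ℝ) ≤ #(A * B) := by
    exact_mod_cast card_image_toUnit_mul_le A B
  have hM₂ : (#(A'.image ShiftUnit.succUnit * B'.image ShiftUnit.succUnit) : ℝ) ≤
      #((A + {1}) * (B + {1})) := by
    exact_mod_cast card_image_succUnit_mul_le A B
  set M : ℝ := (#(A * B) : ℝ) + #((A + {1}) * (B + {1})) with hM
  have hMM : (#(A'.image ShiftUnit.toUnit * B'.image ShiftUnit.toUnit) : ℝ) *
      #(A'.image ShiftUnit.succUnit * B'.image ShiftUnit.succUnit) ≤ M * M := by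
    refine mul_le_mul (hM₁.trans ?_) (hM₂.trans ?_) (Nat.cast_nonneg _) (by positivity)
    · rw [hM]; linarith [(Nat.cast_nonneg _ : (0 : ℝ) ≤ #((A + {1}) * (B + {1})))]
    · rw [hM]; linarith [(Nat.cast_nonneg _ : (0 : ℝ) ≤ #(A * B))]
  -- With at least four elements, discarding 0 and -1 keeps at least half of each set.
  have hab : (#A : ℝ) * #B ≤ 4 * (#A' * #B') := by
    have h1 : #A ≤ 2 * #A' := by omega
    have h2 : #B ≤ 2 * #B' := by omega
    have h3 : #A * #B ≤ (2 * #A') * (2 * #B') := Nat.mul_le_mul h1 h2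
    have h4 : #A * #B ≤ 4 * (#A' * #B') := h3.trans (le_of_eq (by ring))
    exact_mod_cast h4
  have hM0 : 0 ≤ M := by positivity
  have hfinal : ((#A' : ℝ) * #B') ^ 49 ≤
      (c * (3 * L) ^ 36) ^ 2 * (686 * (3 * L) ^ 3) ^ 22 * (6 * L) ^ 98 * (M * M) ^ 38 := by
    refine hmain.trans ?_
    gcongr
  -- The logarithms total `72 + 66 + 98 = 236`, rounded up to `304 = 4 * 76` so that the 76th root
  -- is `L ^ 4`.
  have hL236 : L ^ 236 ≤ L ^ 304 := pow_le_pow_right₀ hL1 (by norm_num)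
  have hsplit : (c * (3 * L) ^ 36) ^ 2 * (686 * (3 * L) ^ 3) ^ 22 * (6 * L) ^ 98 *
      (M * M) ^ 38 = K * (M ^ 76 * L ^ 236) := by rw [hKdef]; ring
  rw [hsplit] at hfinal
  calc ((#A : ℝ) * #B) ^ 49 ≤ (4 * ((#A' : ℝ) * #B')) ^ 49 := by gcongr
    _ = 4 ^ 49 * ((#A' : ℝ) * #B') ^ 49 := mul_pow _ _ _
    _ ≤ 4 ^ 49 * (K * (M ^ 76 * L ^ 236)) := by gcongr
    _ ≤ 4 ^ 49 * (K * (M ^ 76 * L ^ 304)) :=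
        mul_le_mul_of_nonneg_left (mul_le_mul_of_nonneg_left
          (mul_le_mul_of_nonneg_left hL236 (pow_nonneg hM0 _)) hK.le) (by norm_num)
    _ = _ := by ring

theorem exists_rpow_le_log_pow_mul : ∃ C : ℝ, 0 < C ∧ ∀ A B : Finset ℝ,
    A.Nonempty → B.Nonempty →
    ((#A : ℝ) * #B) ^ ((49 : ℝ) / 76) ≤ C * (Real.log ((#A : ℝ) * #B + 2) ^ 4 *
      ((#(A * B) : ℝ) + #((A + {1}) * (B + {1})))) := by
  obtain ⟨C, hC, h⟩ := exists_pow_le_of_four_le_card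
  -- The summand 4 covers the case of a set with fewer than four elements, where `|A||B| ≤ 4 M`.
  refine ⟨C ^ ((1 : ℝ) / 76) + 4, by positivity, fun A B hA hB => ?_⟩
  have hA1 : (1 : ℝ) ≤ #A := by exact_mod_cast hA.card_pos
  have hB1 : (1 : ℝ) ≤ #B := by exact_mod_cast hB.card_pos
  have hn1 : 1 ≤ (#A : ℝ) * #B := one_le_mul_of_one_le_of_one_le hA1 hB1
  have hL1 := one_le_log_add_two hn1
  have hMA : (#A : ℝ) ≤ (#(A * B) : ℝ) + #((A + {1}) * (B + {1})) := by
    exact_mod_cast card_le_card_mul_add_card_shift_mul A hB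
  have hMB : (#B : ℝ) ≤ (#(A * B) : ℝ) + #((A + {1}) * (B + {1})) := by
    rw [mul_comm A, mul_comm (A + {1})]
    exact_mod_cast card_le_card_mul_add_card_shift_mul B hA
  set L := Real.log ((#A : ℝ) * #B + 2)
  set M : ℝ := (#(A * B) : ℝ) + #((A + {1}) * (B + {1}))
  have hM0 : 0 ≤ M := by positivity
  have hL4 : 1 ≤ L ^ 4 := one_le_pow₀ hL1
  have hLM : M ≤ L ^ 4 * M := le_mul_of_one_le_left hM0 hL4
  have hLM0 : 0 ≤ L ^ 4 * M := hM0.trans hLM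
  have hC0 : 0 ≤ C ^ ((1 : ℝ) / 76) := by positivity
  by_cases h4 : 4 ≤ #A ∧ 4 ≤ #B
  · have h1 := Real.rpow_le_rpow (z := 1 / 76) (by positivity) (h A B h4.1 h4.2) (by norm_num)
    rw [Real.mul_rpow hC.le (by positivity), ← Real.rpow_natCast, ← Real.rpow_natCast _ 76,
      ← Real.rpow_mul (by positivity), ← Real.rpow_mul hLM0] at h1
    norm_num at h1
    norm_num
    nlinarith
  · have h2 : ((#A : ℝ) * #B) ^ ((49 : ℝ) / 76) ≤ (#A : ℝ) * #B := by
      conv_rhs => rw [← Real.rpow_one ((#A : ℝ) * #B)]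
      exact Real.rpow_le_rpow_of_exponent_le hn1 (by norm_num)
    have h3 : (#A : ℝ) * #B ≤ 4 * M := by
      rcases not_and_or.1 h4 with h5 | h5
      · have : (#A : ℝ) ≤ 4 := by exact_mod_cast (not_le.1 h5).le
        nlinarith
      · have : (#B : ℝ) ≤ 4 := by exact_mod_cast (not_le.1 h5).le
        nlinarith
    nlinarith [mul_nonneg hC0 hLM0]

theorem exists_mul_shift_mul_bound : ∃ c : ℝ, 0 < c ∧ ∃ k : ℕ, ∀ A B : Finset ℝ,
    c * ((A.card : ℝ) * (B.card : ℝ)) ^ ((49 : ℝ) / 76)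
        / Real.log ((A.card : ℝ) * (B.card : ℝ) + 2) ^ k
      ≤ ((A * B).card : ℝ) + (((A + {1}) * (B + {1})).card : ℝ) := by
  obtain ⟨C, hC, h⟩ := exists_rpow_le_log_pow_mul
  refine ⟨C⁻¹, by positivity, 4, fun A B => ?_⟩
  rcases A.eq_empty_or_nonempty with rfl | hA
  · simp
  rcases B.eq_empty_or_nonempty with rfl | hB
  · simp
  have hn : 0 ≤ (#A : ℝ) * #B := by positivity
  have hL : 0 < Real.log ((#A : ℝ) * #B + 2) := Real.log_pos (by linarith)
  rw [div_le_iff₀ (by positivity), inv_mul_le_iff₀ hC, mul_comm (_ + _)]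
  exact h A B hA hB

theorem card_mul_neg_shift (A : Finset ℝ) : #(A * -(A + {1})) = #(A * (A + {1})) := by
  rw [mul_neg, card_neg]

theorem card_shift_mul_neg_shift (A : Finset ℝ) :
    #((A + {1}) * (-(A + {1}) + {1})) = #(A * (A + {1})) := by
  have h : -(A + {1}) + {1} = -A := by
    ext x
    simp only [mem_add, mem_singleton, mem_neg, exists_eq_left]
    constructor
    · rintro ⟨_, ⟨_, ⟨a, ha, rfl⟩, rfl⟩, rfl⟩
      exact ⟨a, ha, by ring⟩
    · rintro ⟨a, ha, rfl⟩
      exact ⟨_, ⟨_, ⟨a, ha, rfl⟩, rfl⟩, by ring⟩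
  rw [h, mul_neg, card_neg, mul_comm]

end RealNumbers

theorem mainTheorem6 :
    (∃ c : ℝ, 0 < c ∧ ∃ k : ℕ, ∀ A : Finset ℝ,
      c * (A.card : ℝ) ^ ((49 : ℝ) / 38) / Real.log ((A.card : ℝ) + 2) ^ k
        ≤ ((A * (A + {1})).card : ℝ)) ∧
    (∃ c : ℝ, 0 < c ∧ ∃ k : ℕ, ∀ A B : Finset ℝ,
      c * ((A.card : ℝ) * (B.card : ℝ)) ^ ((49 : ℝ) / 76)
          / Real.log ((A.card : ℝ) * (B.card : ℝ) + 2) ^ k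
        ≤ ((A * B).card : ℝ) + (((A + {1}) * (B + {1})).card : ℝ)) := by
  refine ⟨?_, exists_mul_shift_mul_bound⟩
  obtain ⟨c, hc, k, h⟩ := exists_mul_shift_mul_bound
  -- With `B = -(A + 1)` both products have the size of `A (A + 1)`, which costs a factor 2; `log
  -- (a^2 + 2) ≤ 2 log (a + 2)` costs `2 ^ k`.
  refine ⟨c / 2 ^ (k + 1), by positivity, k, fun A => ?_⟩
  have h1 := h A (-(A + {1}))
  rw [card_mul_neg_shift, card_shift_mul_neg_shift, card_neg, card_add_singleton] at h1
  set a : ℝ := (#A : ℝ)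
  have ha : 0 ≤ a := Nat.cast_nonneg _
  have hpow : (a * a) ^ ((49 : ℝ) / 76) = a ^ ((49 : ℝ) / 38) := by
    rw [← sq, ← Real.rpow_natCast, ← Real.rpow_mul ha]
    norm_num
  have hlog0 : 0 < Real.log (a * a + 2) := Real.log_pos (by nlinarith)
  have hlog : Real.log (a * a + 2) ≤ 2 * Real.log (a + 2) := by
    rw [← Real.log_rpow (by linarith)]
    refine Real.log_le_log (by positivity) ?_
    norm_num
    nlinarith
  rw [hpow] at h1
  have h2 : c * a ^ ((49 : ℝ) / 38) / (2 * Real.log (a + 2)) ^ k ≤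
      c * a ^ ((49 : ℝ) / 38) / Real.log (a * a + 2) ^ k := by
    gcongr
  have h3 : c / 2 ^ (k + 1) * a ^ ((49 : ℝ) / 38) / Real.log (a + 2) ^ k =
      c * a ^ ((49 : ℝ) / 38) / (2 * Real.log (a + 2)) ^ k / 2 := by
    rw [mul_pow, pow_succ]
    field_simp
  rw [h3]
  linarith
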